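/- **Setting.** Let $\Sigma$ be a finite alphabet, $b=\lceil\log_2|\Sigma|\rceil$, $r=b+1$, $n\ge 1$, $\ell\ge 2$, $\ell_{\mathsf{bit}}=\ell r$, $\varepsilon>0$, $\beta\in(0,1)$ and $\tau_\bot>0$. A dataset is $\mathcal D=(S_1,\dots,S_n)$ with $S_i\in\Sigma^*$, $1\le|S_i|\le\ell$; two datasets are neighbours if they differ in exactly one $S_i$. A fixed injective code $E$ maps each symbol of $\Sigma$ to a block $x\$$ with $x\in\{0,1\}^b$ and is extended to strings by concatenation; $f_{\mathcal D}(P)$ is the total number of occurrences of $P$ in $E(S_1),\dots,E(S_n)$. Laws $\mu,\nu$ are $\varepsilon$-indistinguishable if $e^{-\varepsilon}\mu(F)\le\nu(F)\le e^{\varepsilon}\mu(F)$ for all events $F$, and an algorithm is $\varepsilon$-differentially private ($\varepsilon$-DP) if its output laws on any two neighbours are $\varepsilon$-indistinguishable. **Algorithm DPFreqSub.** Let $L=\lceil\log_2\ell\rceil$, let $\lambda>0$ be the number for which a phase is given the budget $\varepsilon/\lambda$, and put $$\varepsilon_0=\frac{\varepsilon/\lambda}{4\ell\log_2(n\ell_{\mathsf{bit}})},\qquad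 \sigma=\varepsilon_0^{-1}\log_2\ell_{\mathsf{bit}},\qquad \tau=4\varepsilon_0^{-1}\log_2(\ell_{\mathsf{bit}})\ln(n\ell_{\mathsf{bit}}/\beta)+\tau_\bot .$$ *First phase:* $C_r$ is the set of all $\gamma\in\{0,1\}^{b}\$$ with $f_{\mathcal D}(\gamma)+Z_\gamma>\tau$, with independent $Z_\gamma\sim\mathrm{Lap}(2\ell\lambda/\varepsilon)$. *Main loop,* for $i=1,\dots,L-1$, with $k=r2^{i-1}$: terminate if $|C_k|>n/\log_2\ell_{\mathsf{bit}}$ (the sets found so far are kept). Otherwise let $T_k$ be the path-compressed trie of all suffixes of strings in $C_k$ that start at a position $\equiv1\pmod r$, with a heavy-light decomposition: a heavy edge leads to a child with the largest number of nodes of the compressed trie in its subtree, ties being broken by any rule that depends only on the tree; a position inside a compressed edge counts as a node with a single child when paths are traversed, but not when subtree sizes are counted. For every $s\in C_k$ search $s\circ T_k$ depth-first, character by character, from the node spelling $s$ to depth at most $2k$. At each node reached, its noisy frequency is the current prefix sum returned by a binary tree mechanism run along its heavy path $u=(u_0,\dots,u_d)$ on the difference vector $$\Delta_{\mathcal D}(u)=\bigl(f_{\mathcal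 D}(u_0),\,f_{\mathcal D}(u_1)-f_{\mathcal D}(u_0),\dots,f_{\mathcal D}(u_d)-f_{\mathcal D}(u_{d-1})\bigr),$$ where a node is identified with the string it spells. This mechanism adds one independent $\mathrm{Lap}(\sigma)$ variable to each dyadic interval sum, and answers a prefix sum by the sum of the noisy counts of the dyadic intervals given by the binary expansion of the prefix length. If the noisy frequency exceeds $\tau$, the string of the node, of length $k+t$, is put into $C_{k+t}$ and the search goes on to the children; otherwise the search is pruned at this node. *Output:* $\bigcup_{j\le\ell_{\mathsf{bit}},\,r\mid j}C_j$. **Claim.** For every $\lambda>0$: 1. The first phase is $(\varepsilon/\lambda)$-DP. 2. For each $1\le i\le L-1$, $k=r2^{i-1}$, and each fixed set $C_k$ of concatenations of $2^{i-1}$ blocks from $\{0,1\}^b\$$, the $i$-th phase of the main loop is $(\varepsilon/\lambda)$-DP. 3. For each $1\le i\le L$, $k=r2^{i-1}$, each such $C_k$ with $|C_k|\le n/\log_2\ell_{\mathsf{bit}}$, and all neighbours $\mathcal D,\mathcal D'$, $$\sum_{s\in C_k}\ \sum_{u\text{ heavy path of }s\circ T_k}\|\Delta_{\mathcal D}(u)-\Delta_{\mathcal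 D'}(u)\|_1\le 4\ell\log_2(n\ell_{\mathsf{bit}}).$$ 4. The joint release of all sets $C_j$, and hence the output of DPFreqSub, is $(L\varepsilon/\lambda)$-DP. In particular DPFreqSub is $\varepsilon$-DP whenever $\lambda\ge L$. So with $\lambda=\log_2\ell$ each of the $L$ phases is $(\varepsilon/\log_2\ell)$-DP, and with $\lambda=L=\lceil\log_2\ell\rceil$ (which is $\log_2\ell$ if $\ell$ is a power of two) each phase is $(\varepsilon/L)$-DP and the algorithm is $\varepsilon$-DP. -/

import Mathlib

open MeasureTheory

noncomputable section

namespace FreqSub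

/-! ### Differential privacy -/

/-- `ε`-indistinguishability of two measures. -/
def Indistinguishable {Z : Type*} [MeasurableSpace Z] (ε : ℝ) (μ ν : Measure Z) : Prop :=
  ∀ E : Set Z, MeasurableSet E →
    ENNReal.ofReal (Real.exp (-ε)) * μ E ≤ ν E ∧ ν E ≤ ENNReal.ofReal (Real.exp ε) * μ E

/-- `M`, which maps an input to the law of the output, is a randomized algorithm (all laws are
probability measures) and is `ε`-differentially private for the neighbouring relation `nbr`. -/
def IsDP {Y Z : Type*} [MeasurableSpace Z] (nbr : Y → Y → Prop) (ε : ℝ) (M : Y → Measure Z) :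
    Prop :=
  (∀ y, IsProbabilityMeasure (M y)) ∧ ∀ y y', nbr y y' → Indistinguishable ε (M y) (M y')

/-- The Laplace distribution with scale `b` (density `exp (-|x| / b) / (2 b)`), for `b > 0`. -/
def laplace (b : ℝ) : Measure ℝ :=
  volume.withDensity fun x => ENNReal.ofReal (1 / (2 * b) * Real.exp (-|x| / b))

/-! ### The binary tree mechanism

The dyadic node `(a, c)` is the interval of (zero-based) positions `[c * 2 ^ a, (c + 1) * 2 ^ a)`. -/

/-- The dyadic intervals, one for every binary digit `1` of `t`, that partition the first `t`
positions `{0, …, t - 1}`. -/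
def dyadicNodes (t : ℕ) : Finset (ℕ × ℕ) :=
  ((Finset.range t).filter fun a => t.testBit a = true).image fun a => (a, 2 * (t / 2 ^ (a + 1)))

/-- Noisy count of the dyadic node `I` on the stream `x`, where `z I` is the noise of the node. -/
def dyadicCount (x : ℕ → ℝ) (z : ℕ × ℕ → ℝ) (I : ℕ × ℕ) : ℝ :=
  (∑ i ∈ Finset.Ico (I.2 * 2 ^ I.1) ((I.2 + 1) * 2 ^ I.1), x i) + z I

/-- The answer of the binary tree mechanism after `t` increments `x 0, …, x (t - 1)`: the noisy
prefix sum. The noise `z` of a node is drawn once and reused in all later queries. -/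
def treeQuery (x : ℕ → ℝ) (z : ℕ × ℕ → ℝ) (t : ℕ) : ℝ :=
  ∑ I ∈ dyadicNodes t, dyadicCount x z I

/-! ### Strings -/

/-- Strings over the symbols `0`, `1`, `$`, which are `some false`, `some true`, `none`. -/
abbrev Str := List (Option Bool)

/-- Number of occurrences of `P` in `W`. -/
def occ (P W : Str) : ℕ := ((Finset.range W.length).filter fun j => P <+: W.drop j).card

/-- The block `x$` for a bit string `x` of length `b`. -/
def block {b : ℕ} (x : Fin b → Bool) : Str := (List.ofFn x).map some ++ [none]

/-- `w` is a concatenation of `m` blocks `x$`, where `x` has length `b`. -/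
def IsBlockString (b m : ℕ) (w : Str) : Prop :=
  ∃ L : List (Fin b → Bool), L.length = m ∧ w = L.flatMap block

/-! ### Sparse suffix trees

A trie is given by the finite set of the strings spelled by its nodes. The path-compressed trie is
handled through the uncompressed one: all nodes of the latter are the loci of the former, and the
explicit nodes are those that survive the contraction of the non-branching paths. -/

/-- The suffixes of the strings in `C` that start at a (zero-based) index divisible by `r`. -/
def spacedSuffixes (r : ℕ) (C : Finset Str) : Finset Str :=
  C.biUnion fun s => ((Finset.range s.length).filter fun j => r ∣ j).image fun j => s.drop j

/-- The loci of the `r`-spaced sparse suffix tree of `C`; the root is `[]`. -/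
def sparseSuffixTree (r : ℕ) (C : Finset Str) : Finset Str :=
  insert [] ((spacedSuffixes r C).biUnion fun x => x.inits.toFinset)

/-- The symbols on the edges leaving the node `q`. -/
def childSymbols (T : Finset Str) (q : Str) : Finset (Option Bool) :=
  Finset.univ.filter fun c => q ++ [c] ∈ T

/-- The nodes of the path-compressed trie: the root, the branching nodes and the leaves. -/
def explicitNodes (T : Finset Str) : Finset Str :=
  T.filter fun q => q = [] ∨ (childSymbols T q).card ≠ 1

/-- Number of nodes of the path-compressed trie in the subtree below the locus `q`. -/
def subtreeSize (T : Finset Str) (q : Str) : ℕ := ((explicitNodes T).filter fun p => q <+: p).card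

/-! ### Heavy-light decomposition -/

/-- `hv` selects, in every tree and at every non-leaf, the symbol of an edge to a child with a
subtree of largest size; ties are broken arbitrarily. -/
def IsHeavyChoice (hv : Finset Str → Str → Option Bool) : Prop :=
  ∀ T q, (childSymbols T q).Nonempty →
    hv T q ∈ childSymbols T q ∧
      ∀ c ∈ childSymbols T q, subtreeSize T (q ++ [c]) ≤ subtreeSize T (q ++ [hv T q])

/-- `q` is the root of a heavy path: it is the root of the tree, or the edge to it is light. -/
def IsHead (hv : Finset Str → Str → Option Bool) (T : Finset Str) (q : Str) : Prop :=
  q = [] ∨ q ≠ q.dropLast ++ [hv T q.dropLast]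

open Classical in
/-- The roots of all heavy paths of `T`; they stand for the heavy paths. -/
def heads (hv : Finset Str → Str → Option Bool) (T : Finset Str) : Finset Str :=
  T.filter fun q => IsHead hv T q

open Classical in
/-- The root of the heavy path that contains `q`: the longest prefix of `q` that is a head. -/
def headOf (hv : Finset Str → Str → Option Bool) (T : Finset Str) (q : Str) : Str :=
  q.take (Nat.findGreatest (fun j => IsHead hv T (q.take j)) q.length)

/-- The node `u_j` of the heavy path `u_0, u_1, …` with root `u_0 = h`. -/
def pathNode (hv : Finset Str → Str → Option Bool) (T : Finset Str) (h : Str) : ℕ → Str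
  | 0 => h
  | j + 1 => pathNode hv T h j ++ [hv T (pathNode hv T h j)]

/-- The number of nodes of the heavy path with root `h`. -/
def pathLength (hv : Finset Str → Str → Option Bool) (T : Finset Str) (h : Str) : ℕ :=
  (T.filter fun q => headOf hv T q = h).card

/-! ### The algorithm -/

/-- The parameters of the algorithm, for the alphabet `A`. -/
structure Params (A : Type*) [Fintype A] where
  /-- number of users -/
  n : ℕ
  /-- maximal length of a user's string -/
  len : ℕ
  /-- privacy budget -/
  ε : ℝ
  /-- the budget of a phase is `ε / lam` -/
  lam : ℝ
  /-- failure probability -/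
  β : ℝ
  /-- lower threshold -/
  τbot : ℝ
  /-- the codebook, `⌈log₂ |A|⌉` bits for a symbol -/
  code : A ↪ (Fin (Nat.clog 2 (Fintype.card A)) → Bool)
  /-- the choice of the heavy edges -/
  hv : Finset Str → Str → Option Bool

namespace Params

variable {A : Type*} [Fintype A] (p : Params A)

/-- A dataset: a non-empty string of length at most `len` for each of the `n` users. -/
abbrev Dataset : Type _ := Fin p.n → {S : List A // 1 ≤ S.length ∧ S.length ≤ p.len}

/-- Two datasets differ in the string of exactly one user. -/
def Neighbor (D D' : p.Dataset) : Prop := ∃ i, D i ≠ D' i ∧ ∀ j, j ≠ i → D j = D' j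

/-- `⌈log₂ |A|⌉` -/
def bits (_ : Params A) : ℕ := Nat.clog 2 (Fintype.card A)

/-- The length of a block. -/
def r : ℕ := p.bits + 1

/-- The maximal length of an encoded string. -/
def lenBit : ℕ := p.len * p.r

/-- The number `⌈log₂ len⌉` of phases. -/
def numPhases : ℕ := Nat.clog 2 p.len

/-- The blockwise encoding of a string. -/
def encode (S : List A) : Str := S.flatMap fun a => block (p.code a)

/-- The frequency of `P` in the encoded dataset. -/
def freq (D : p.Dataset) (P : Str) : ℝ := ∑ i, (occ P (p.encode (D i).1) : ℝ)

/-- The calibration parameter of the binary tree mechanisms. -/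
def ε₀ : ℝ := (p.ε / p.lam) / (4 * p.len * Real.logb 2 (p.n * p.lenBit))

/-- The noise scale of the binary tree mechanisms. -/
def σ : ℝ := p.ε₀⁻¹ * Real.logb 2 p.lenBit

/-- The threshold of the algorithm. -/
def τ : ℝ := 4 * p.ε₀⁻¹ * Real.logb 2 p.lenBit * Real.log (p.n * p.lenBit / p.β) + p.τbot

/-- The law of `C_r`, the set published in the first phase: Laplace mechanism and threshold. -/
def firstPhase (D : p.Dataset) : Measure (Finset Str) :=
  (Measure.pi fun _ : Fin p.bits → Bool => laplace (2 * p.len * p.lam / p.ε)).map fun z =>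
    (Finset.univ.filter fun x => p.τ < p.freq D (block x) + z x).image block

/-- The frequency-difference vector of the heavy path with root `s ∘ h` in the tree `s ∘ T`. -/
def diffVec (D : p.Dataset) (T : Finset Str) (s h : Str) : ℕ → ℝ
  | 0 => p.freq D (s ++ h)
  | j + 1 => p.freq D (s ++ pathNode p.hv T h (j + 1)) - p.freq D (s ++ pathNode p.hv T h j)

/-- The noisy count of the node `s ∘ q` of `s ∘ T`: the answer of the binary tree mechanism of the
heavy path that contains the node, when the stream has reached the node. The mechanism is named by
the root of the path, and `z (root, I)` is the noise of its dyadic node `I`. -/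
def noisyCount (D : p.Dataset) (T : Finset Str) (z : Str × (ℕ × ℕ) → ℝ) (s q : Str) : ℝ :=
  treeQuery (p.diffVec D T s (headOf p.hv T q)) (fun I => z (s ++ headOf p.hv T q, I))
    (q.length - (headOf p.hv T q).length + 1)

/-- Depth-first search in `T` from the node `q`, with depth limit, where nodes that fail
`τ < count` are pruned; the result is the set of the nodes that pass. -/
def search (T : Finset Str) (count : Str → ℝ) (τ : ℝ) : ℕ → Str → Finset Str
  | 0, _ => ∅
  | fuel + 1, q =>
    if τ < count q then
      insert q ((childSymbols T q).biUnion fun c => search T count τ fuel (q ++ [c]))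
    else ∅

/-- The strings found when the trees `s ∘ T_k` are searched, `s ∈ C`, with noise `z`. -/
def extend (k : ℕ) (C : Finset Str) (D : p.Dataset) (z : Str × (ℕ × ℕ) → ℝ) : Finset Str :=
  C.biUnion fun s =>
    (search (sparseSuffixTree p.r C) (p.noisyCount D (sparseSuffixTree p.r C) z s) p.τ
      (k + 1) []).image fun q => s ++ q

/-- The law of the (disjoint) union of the sets `C_{k+1}, …, C_{2k}` (and of the strings of `C_k`
that pass the test anew) which are published in the phase with `C_k = C`. All noise is independent.
The phase finds nothing if `C` is too large; there is then nothing to extend in later phases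
either, so that this is the termination of the algorithm. -/
def extensionPhase (k : ℕ) (C : Finset Str) (D : p.Dataset) : Measure (Finset Str) :=
  if (p.n : ℝ) / Real.logb 2 p.lenBit < C.card then Measure.dirac ∅
  else (Measure.infinitePi fun _ : Str × (ℕ × ℕ) => laplace p.σ).map fun z => p.extend k C D z

/-- The law of the union of all candidate sets `C_j` that are known after the first phase and the
phases `1, …, i` of the main loop; `C_j` consists of the strings of length `j` in the union. -/
def run (D : p.Dataset) : ℕ → Measure (Finset Str)
  | 0 => p.firstPhase D
  | i + 1 => (run D i).bind fun U =>
      (p.extensionPhase (p.r * 2 ^ i) (U.filter fun w => w.length = p.r * 2 ^ i) D).map fun N =>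
        U ∪ N

/-- The law of all candidate sets `C_j`, `j ≤ lenBit`, at the end of the execution. -/
def transcript (D : p.Dataset) : Measure (Finset Str) := p.run D (p.numPhases - 1)

/-- The law of the output: the union of the sets `C_j` with `j ≤ lenBit` and `r ∣ j`. -/
def dpFreqSub (D : p.Dataset) : Measure (Finset Str) :=
  (p.transcript D).map fun U => U.filter fun w => w.length ≤ p.lenBit ∧ p.r ∣ w.length

/-- The total `L₁` distance of the difference vectors, over all heavy paths in the trees `s ∘ T_k`,
`s ∈ C`, where `C = C_k`. -/
def heavyPathDistance (C : Finset Str) (D D' : p.Dataset) : ℝ :=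
  ∑ s ∈ C, ∑ h ∈ heads p.hv (sparseSuffixTree p.r C),
    ∑ j ∈ Finset.range (pathLength p.hv (sparseSuffixTree p.r C) h),
      |p.diffVec D (sparseSuffixTree p.r C) s h j - p.diffVec D' (sparseSuffixTree p.r C) s h j|

end Params

end FreqSub

end

noncomputable section

namespace FreqSub

open scoped ENNReal

/-! ### Measure-theoretic tools -/

/-! Replacing one user's string changes every frequency by the difference of the numbers of
occurrences in two block strings of at most ℓ blocks each. Along a heavy path the occurrences in one
block string are antitone, so their increments have L₁ norm at most twice the number at the root.
Summing over the roots means counting, for each position of the block string, the pairs (s, h) with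
s ∘ h occurring there. As s starts with a block and `$` marks the ends of blocks, at most ℓ
positions are possible. At each of them s is determined by its length, and h is a root that is a
prefix of the remaining text. Along a light edge the number of forks plus one at least halves, so
there are at most log₂ (2 · leaves) such h, and the bound on |C| makes this at most log₂(nℓ_bit).
The two strings together give 4ℓ log₂(nℓ_bit) (`sum_occ_heads_le`, `sum_abs_diffVec_sub_le`).

In a binary tree mechanism an entry of the stream enters at most one dyadic sum per level. Shifting
the Laplace noise by the changes of the dyadic sums turns the run on D into the run on D' at an L₁
cost of levels times sensitivity, and σ is calibrated to this (`extend_eq_shift`,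
`levels_mul_natLog_le`). The search is post-processing of the noisy counts. The phases compose
adaptively (`IsDP.bind`), since almost surely the strings handed to the next phase are again
concatenations of blocks (`ae_isCandidateSet_run`). -/

theorem lintegral_laplace_density {b : ℝ} (hb : 0 < b) :
    ∫⁻ x : ℝ, ENNReal.ofReal (1 / (2 * b) * Real.exp (-|x| / b)) = 1 := by
  have hint : ∫ x : ℝ, 1 / (2 * b) * Real.exp (-|x| / b) = 1 := by
    rw [integral_comp_abs (f := fun x => 1 / (2 * b) * Real.exp (-x / b)),
      integral_const_mul]
    have h := integral_exp_mul_Ioi (a := -1 / b) (by rw [neg_div, neg_lt_zero]; positivity) 0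
    have h' : ∀ x : ℝ, Real.exp (-x / b) = Real.exp (-1 / b * x) := fun x => by
      congr 1; ring
    simp only [h', h]
    simp
    field_simp
  -- A non-integrable function has integral 0 by convention, so the value 1 already proves
  -- integrability.
  have hI : Integrable (fun x : ℝ => 1 / (2 * b) * Real.exp (-|x| / b)) := by
    by_contra h
    rw [integral_undef h] at hint
    exact zero_ne_one hint
  rw [← ofReal_integral_eq_lintegral_ofReal hI (ae_of_all _ fun x => by positivity), hint]
  simp

theorem isProbabilityMeasure_laplace {b : ℝ} (hb : 0 < b) : IsProbabilityMeasure (laplace b) :=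
  ⟨by rw [laplace, withDensity_apply _ .univ, setLIntegral_univ, lintegral_laplace_density hb]⟩

theorem map_add_laplace_le {b : ℝ} (hb : 0 < b) (v : ℝ) :
    (laplace b).map (fun x => x + v) ≤ ENNReal.ofReal (Real.exp (|v| / b)) • laplace b := by
  refine Measure.le_iff.2 fun s hs => ?_
  have hm : Measurable fun x : ℝ => x + v := by fun_prop
  rw [Measure.map_apply hm hs, Measure.smul_apply, laplace, withDensity_apply _ (hm hs),
    withDensity_apply _ hs, smul_eq_mul, ← lintegral_const_mul _ (by fun_prop),
    ← lintegral_indicator (hm hs), ← lintegral_indicator hs,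
    ← lintegral_add_right_eq_self (s.indicator _) v]
  refine lintegral_mono fun x => ?_
  by_cases hx : x + v ∈ s
  · rw [Set.indicator_of_mem (by exact hx), Set.indicator_of_mem hx,
      ← ENNReal.ofReal_mul (Real.exp_nonneg _)]
    refine ENNReal.ofReal_le_ofReal ?_
    rw [mul_left_comm, ← Real.exp_add]
    gcongr
    rw [← add_div]
    gcongr
    linarith [abs_add_le x v]
  · rw [Set.indicator_of_notMem (by exact hx)]
    exact zero_le

/-- Domination on boxes does not in general pass to all measurable sets. Here it does, because the
product measure comes from the largest outer measure that is bounded by the product of the factors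
on boxes. -/
theorem pi_le_prod_smul_pi {ι : Type*} [Fintype ι] {X : ι → Type*} [∀ i, MeasurableSpace (X i)]
    {μ ν : ∀ i, Measure (X i)} [∀ i, SigmaFinite (μ i)] [∀ i, SigmaFinite (ν i)] {c : ι → ℝ≥0∞}
    (hc0 : ∀ i, c i ≠ 0) (hc : ∀ i, c i ≠ ⊤) (h : ∀ i, μ i ≤ c i • ν i) :
    Measure.pi μ ≤ (∏ i, c i) • Measure.pi ν := by
  have h0 : ∏ i, c i ≠ 0 := Finset.prod_ne_zero_iff.2 fun i _ => hc0 i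
  have ht : ∏ i, c i ≠ ⊤ := ENNReal.prod_ne_top fun i _ => hc i
  have key : ((∏ i, c i)⁻¹ • Measure.pi μ).toOuterMeasure ≤
      OuterMeasure.pi fun i => (ν i).toOuterMeasure := by
    refine OuterMeasure.le_pi.2 fun s _ => ?_
    rw [Measure.coe_toOuterMeasure, Measure.smul_apply, Measure.pi_pi, smul_eq_mul]
    calc (∏ i, c i)⁻¹ * ∏ i, μ i (s i) ≤ (∏ i, c i)⁻¹ * ∏ i, c i * ν i (s i) := by
          gcongr with i
          exact h i (s i)
      _ = ∏ i, ν i (s i) := by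
          rw [Finset.prod_mul_distrib, ← mul_assoc, ENNReal.inv_mul_cancel h0 ht, one_mul]
  refine Measure.le_iff.2 fun s hs => ?_
  have h1 := key s
  rw [Measure.coe_toOuterMeasure, Measure.smul_apply, smul_eq_mul] at h1
  have h2 : OuterMeasure.pi (fun i => (ν i).toOuterMeasure) s ≤ Measure.pi ν s := by
    rw [Measure.pi]
    exact le_toMeasure_apply _ _ _
  rw [Measure.smul_apply, smul_eq_mul]
  calc Measure.pi μ s = (∏ i, c i) * ((∏ i, c i)⁻¹ * Measure.pi μ s) := by
        rw [← mul_assoc, ENNReal.mul_inv_cancel h0 ht, one_mul]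
    _ ≤ _ := by gcongr; exact h1.trans h2

theorem map_add_pi_laplace_le {ι : Type*} [Fintype ι] {b : ℝ} (hb : 0 < b) (v : ι → ℝ) :
    (Measure.pi fun _ : ι => laplace b).map (fun z i => z i + v i) ≤
      ENNReal.ofReal (Real.exp ((∑ i, |v i|) / b)) • Measure.pi fun _ : ι => laplace b := by
  have := isProbabilityMeasure_laplace hb
  have hp : ∀ i, IsProbabilityMeasure ((laplace b).map fun x => x + v i) := fun i =>
    Measure.isProbabilityMeasure_map (by fun_prop)
  rw [Measure.pi_map_pi (f := fun i x => x + v i) fun i => by fun_prop]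
  refine (pi_le_prod_smul_pi (c := fun i => ENNReal.ofReal (Real.exp (|v i| / b)))
    (fun i => by simp [Real.exp_pos]) (fun i => ENNReal.ofReal_ne_top)
    fun i => map_add_laplace_le hb (v i)).trans_eq ?_
  rw [← ENNReal.ofReal_prod_of_nonneg fun i _ => Real.exp_nonneg _, ← Real.exp_sum,
    ← Finset.sum_div]

/-- The Laplace mechanism: if shifting the noise by `v` turns the outcome `F` into `G`, then their
laws are comparable. -/
theorem map_pi_laplace_le {ι Z : Type*} [Fintype ι] [MeasurableSpace Z] {b e : ℝ} (hb : 0 < b)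
    {F G : (ι → ℝ) → Z} (hG : Measurable G) (v : ι → ℝ)
    (hFG : ∀ z, F z = G fun i => z i + v i) (hv : ∑ i, |v i| ≤ e * b) :
    (Measure.pi fun _ : ι => laplace b).map F ≤
      ENNReal.ofReal (Real.exp e) • (Measure.pi fun _ : ι => laplace b).map G := by
  have hs : Measurable fun (z : ι → ℝ) i => z i + v i := by fun_prop
  have hF : F = G ∘ fun z i => z i + v i := funext hFG
  rw [hF, ← Measure.map_map hG hs, ← Measure.map_smul]
  refine Measure.map_mono ((map_add_pi_laplace_le hb v).trans ?_) hG
  refine Measure.le_iff.2 fun s _ => ?_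
  simp only [Measure.smul_apply, smul_eq_mul]
  gcongr
  rwa [div_le_iff₀ hb]

/-- The Laplace mechanism for infinitely many noise variables, only those in `J` being used. -/
theorem map_infinitePi_laplace_le {ι Z : Type*} [MeasurableSpace Z] {b e : ℝ} (hb : 0 < b)
    (J : Finset ι) {F G : (ι → ℝ) → Z} (hF : Measurable F) (hG : Measurable G) (v : ι → ℝ)
    (hFJ : ∀ z z', (∀ i ∈ J, z i = z' i) → F z = F z')
    (hGJ : ∀ z z', (∀ i ∈ J, z i = z' i) → G z = G z')
    (hFG : ∀ z, F z = G fun i => z i + v i) (hv : ∑ i ∈ J, |v i| ≤ e * b) :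
    (Measure.infinitePi fun _ : ι => laplace b).map F ≤
      ENNReal.ofReal (Real.exp e) • (Measure.infinitePi fun _ : ι => laplace b).map G := by
  classical
  have := isProbabilityMeasure_laplace hb
  -- Extension by 0 is harmless, since the outcomes ignore the coordinates outside `J`; it reduces
  -- the claim to a finite product.
  let ext : (J → ℝ) → ι → ℝ := fun y i => if h : i ∈ J then y ⟨i, h⟩ else 0
  have hext : Measurable ext := by
    refine measurable_pi_lambda _ fun i => ?_
    by_cases h : i ∈ J
    · simp only [ext, h, dite_true]; fun_prop
    · simp only [ext, h, dite_false]; fun_prop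
  have hres : ∀ {H : (ι → ℝ) → Z}, Measurable H →
      (∀ z z', (∀ i ∈ J, z i = z' i) → H z = H z') →
      (Measure.infinitePi fun _ : ι => laplace b).map H =
        (Measure.pi fun _ : J => laplace b).map (H ∘ ext) := by
    intro H hH hHJ
    rw [← Measure.infinitePi_map_restrict (fun _ : ι => laplace b) (I := J),
      Measure.map_map (hH.comp hext) (Finset.measurable_restrict J)]
    congr 1
    funext z
    exact hHJ _ _ fun i hi => by simp [ext, hi]
  rw [hres hF hFJ, hres hG hGJ]
  refine map_pi_laplace_le hb (hG.comp hext) (fun i => v i) (fun y => ?_) ?_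
  · rw [Function.comp_apply, hFG]
    exact hGJ _ _ fun i hi => by simp [ext, hi]
  · rwa [Finset.sum_coe_sort J fun i => |v i|]

/-! ### Calculus of differential privacy: post-processing and adaptive composition. -/

theorem isDP_of_le {Y Z : Type*} [MeasurableSpace Z] {nbr : Y → Y → Prop} {ε : ℝ}
    {M : Y → Measure Z} (hsymm : ∀ y y', nbr y y' → nbr y' y)
    (hM : ∀ y, IsProbabilityMeasure (M y))
    (h : ∀ y y', nbr y y' → M y ≤ ENNReal.ofReal (Real.exp ε) • M y') : IsDP nbr ε M := by
  refine ⟨hM, fun y y' hy E _ => ⟨?_, h y' y (hsymm _ _ hy) E⟩⟩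
  -- The lower estimate is the upper one in which both factors are moved to the other side; the
  -- upper one uses symmetry.
  calc ENNReal.ofReal (Real.exp (-ε)) * M y E
      ≤ ENNReal.ofReal (Real.exp (-ε)) * (ENNReal.ofReal (Real.exp ε) * M y' E) := by
        gcongr; exact h y y' hy E
    _ = M y' E := by
        rw [← mul_assoc, ← ENNReal.ofReal_mul (Real.exp_nonneg _), ← Real.exp_add]
        simp

theorem IsDP.le {Y Z : Type*} [MeasurableSpace Z] {nbr : Y → Y → Prop} {ε : ℝ}
    {M : Y → Measure Z} (h : IsDP nbr ε M) {y y' : Y} (hy : nbr y y') :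
    M y' ≤ ENNReal.ofReal (Real.exp ε) • M y :=
  Measure.le_iff.2 fun E hE => (h.2 y y' hy E hE).2

theorem isDP_dirac {Y Z : Type*} [MeasurableSpace Z] {nbr : Y → Y → Prop} {ε : ℝ} (hε : 0 ≤ ε)
    (x : Z) : IsDP nbr ε fun _ => Measure.dirac x := by
  refine ⟨fun _ => inferInstance, fun _ _ _ E _ => ⟨?_, ?_⟩⟩
  · refine mul_le_of_le_one_left' ?_
    rw [ENNReal.ofReal_le_one, Real.exp_le_one_iff]
    linarith
  · refine le_mul_of_one_le_left' ?_
    rw [ENNReal.one_le_ofReal]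
    exact Real.one_le_exp hε

theorem IsDP.map {Y Z Z' : Type*} [MeasurableSpace Z] [MeasurableSpace Z'] {nbr : Y → Y → Prop}
    {ε : ℝ} {M : Y → Measure Z} (h : IsDP nbr ε M) {f : Z → Z'} (hf : Measurable f) :
    IsDP nbr ε fun y => (M y).map f := by
  refine ⟨fun y => ?_, fun y y' hy E hE => ?_⟩
  · have := h.1 y
    exact Measure.isProbabilityMeasure_map hf.aemeasurable
  · rw [Measure.map_apply hf hE, Measure.map_apply hf hE]
    exact h.2 y y' hy _ (hf hE)

theorem IsDP.mono {Y Z : Type*} [MeasurableSpace Z] {nbr : Y → Y → Prop} {ε ε' : ℝ}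
    {M : Y → Measure Z} (h : IsDP nbr ε M) (hε : ε ≤ ε') : IsDP nbr ε' M := by
  refine ⟨h.1, fun y y' hy E hE => ⟨le_trans ?_ (h.2 y y' hy E hE).1,
    (h.2 y y' hy E hE).2.trans ?_⟩⟩ <;> gcongr

/-- Adaptive composition, where the second mechanism need only be private for the outcomes of the
first one that have positive probability. -/
theorem IsDP.bind {Y Z Z' : Type*} [MeasurableSpace Z] [DiscreteMeasurableSpace Z]
    [MeasurableSpace Z'] {nbr : Y → Y → Prop} (hsymm : ∀ y y', nbr y y' → nbr y' y) {ε₁ ε₂ : ℝ}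
    {M : Y → Measure Z} {K : Y → Z → Measure Z'} (h : IsDP nbr ε₁ M) {good : Z → Prop}
    (hgood : ∀ y, ∀ᵐ x ∂M y, good x) (hK : ∀ x, good x → IsDP nbr ε₂ fun y => K y x) :
    IsDP nbr (ε₁ + ε₂) fun y => (M y).bind (K y) := by
  have hKm : ∀ y, Measurable (K y) := fun y => .of_discrete
  refine isDP_of_le hsymm (fun y => ⟨?_⟩) fun y y' hy => Measure.le_iff.2 fun E hE => ?_
  · have := h.1 y
    rw [Measure.bind_apply .univ (hKm y).aemeasurable]
    calc ∫⁻ x, K y x Set.univ ∂M y = ∫⁻ _, 1 ∂M y := by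
          refine lintegral_congr_ae ?_
          filter_upwards [hgood y] with x hx
          have := (hK x hx).1 y
          exact measure_univ
      _ = 1 := by simp
  · rw [Measure.smul_apply, Measure.bind_apply hE (hKm y).aemeasurable,
      Measure.bind_apply hE (hKm y').aemeasurable, smul_eq_mul]
    -- The kernel is exchanged before the measure, while the integral is still over `M y`, and only
    -- at good outcomes.
    calc ∫⁻ x, K y x E ∂M y
        ≤ ∫⁻ x, ENNReal.ofReal (Real.exp ε₂) * K y' x E ∂M y := by
          refine lintegral_mono_ae ?_
          filter_upwards [hgood y] with x hx
          exact (hK x hx).le (hsymm _ _ hy) E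
      _ ≤ ∫⁻ x, ENNReal.ofReal (Real.exp ε₂) * K y' x E
            ∂(ENNReal.ofReal (Real.exp ε₁) • M y') :=
          lintegral_mono' (h.le (hsymm _ _ hy)) le_rfl
      _ = ENNReal.ofReal (Real.exp (ε₁ + ε₂)) * ∫⁻ x, K y' x E ∂M y' := by
          rw [lintegral_smul_measure, lintegral_const_mul _ .of_discrete, smul_eq_mul,
            ← mul_assoc, ← ENNReal.ofReal_mul (Real.exp_nonneg _), ← Real.exp_add]

theorem measurable_biUnion {Ω ι α : Type*} [MeasurableSpace Ω] [Countable α] [DecidableEq α]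
    (t : Finset ι) {f : ι → Ω → Finset α} (hf : ∀ i ∈ t, Measurable (f i)) :
    Measurable fun ω => t.biUnion fun i => f i ω := by
  classical
  induction t using Finset.induction with
  | empty => simp
  | insert i t _ ih =>
    simp only [Finset.biUnion_insert]
    have h := (hf i (Finset.mem_insert_self i t)).prodMk
      (ih fun j hj => hf j (Finset.mem_insert_of_mem hj))
    exact (Measurable.of_discrete (f := fun q : Finset α × Finset α => q.1 ∪ q.2)).comp h

/-! ### Occurrences of block strings -/

theorem length_block {b : ℕ} (x : Fin b → Bool) : (block x).length = b + 1 := by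
  simp [block]

theorem length_flatMap_block {b : ℕ} (L : List (Fin b → Bool)) :
    (L.flatMap block).length = L.length * (b + 1) := by
  simp [List.length_flatMap, length_block]

theorem block_injective {b : ℕ} : Function.Injective (block (b := b)) := fun x y h => by
  rw [block, block, List.append_cancel_right_eq] at h
  exact List.ofFn_injective (List.map_injective_iff.2 (Option.some_injective _) h)

theorem getElem?_block_eq_none {b : ℕ} (x : Fin b → Bool) : (block x)[b]? = some none := by
  simp [block]

/-- The symbol `$` occurs only at the end of a block, so its positions reveal the block boundaries.
-/
theorem dvd_of_getElem?_flatMap_block {b : ℕ} (L : List (Fin b → Bool)) :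
    ∀ i, (L.flatMap block)[i]? = some none → (b + 1) ∣ (i + 1) := by
  induction L with
  | nil => simp
  | cons x L ih =>
    intro i hi
    rw [List.flatMap_cons] at hi
    by_cases hib : i < b + 1
    · rw [List.getElem?_append_left (by rwa [length_block])] at hi
      rcases Nat.lt_succ_iff_lt_or_eq.1 hib with h | rfl
      · rw [block, List.getElem?_append_left (by simpa using h)] at hi
        simp [h] at hi
      · exact dvd_rfl
    · push Not at hib
      rw [List.getElem?_append_right (by rwa [length_block]), length_block] at hi
      have h := ih _ hi
      rw [show i + 1 = (i - (b + 1) + 1) + (b + 1) by omega]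
      exact dvd_add h dvd_rfl

/-- A block can occur in a concatenation of blocks only at the start of a block. -/
theorem dvd_of_block_prefix {b : ℕ} {L : List (Fin b → Bool)} {x : Fin b → Bool} {j : ℕ}
    (h : block x <+: (L.flatMap block).drop j) : (b + 1) ∣ j := by
  -- The `$` that ends the occurrence sits at index j + b of the text.
  have h1 : ((L.flatMap block).drop j)[b]? = some none := by
    obtain ⟨t, ht⟩ := h
    rw [← ht, List.getElem?_append_left (by simp [length_block]), getElem?_block_eq_none]
  rw [List.getElem?_drop] at h1
  have h2 := dvd_of_getElem?_flatMap_block L _ h1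
  rw [add_assoc] at h2
  exact (Nat.dvd_add_iff_left dvd_rfl).2 h2

theorem card_range_filter_dvd_le {m r : ℕ} :
    ((Finset.range (m * r)).filter fun j => r ∣ j).card ≤ m := by
  calc _ ≤ ((Finset.range m).image fun i => i * r).card := by
        refine Finset.card_le_card fun j hj => ?_
        rw [Finset.mem_filter, Finset.mem_range] at hj
        obtain ⟨hj, i, rfl⟩ := hj
        rw [mul_comm r i] at hj ⊢
        exact Finset.mem_image_of_mem _ (Finset.mem_range.2 (lt_of_mul_lt_mul_right hj (Nat.zero_le _)))
    _ ≤ m := Finset.card_image_le.trans_eq (Finset.card_range m)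

theorem occ_anti {P Q : Str} (h : P <+: Q) (W : Str) : occ Q W ≤ occ P W :=
  Finset.card_le_card fun _ hj => Finset.mem_filter.2
    ⟨(Finset.mem_filter.1 hj).1, h.trans (Finset.mem_filter.1 hj).2⟩

/-- Total number of occurrences of the strings of a family in a concatenation of blocks, if all
strings of the family start with a block. -/
theorem sum_occ_le {ι : Type*} {b : ℕ} (Q : Finset ι) (f : ι → Str) (K : ℕ)
    (hf : ∀ i ∈ Q, ∃ x : Fin b → Bool, block x <+: f i)
    (hK : ∀ V : Str, (Q.filter fun i => f i <+: V).card ≤ K) (L : List (Fin b → Bool)) :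
    ∑ i ∈ Q, occ (f i) (L.flatMap block) ≤ L.length * K := by
  set W := L.flatMap block with hW
  simp only [occ, Finset.card_filter]
  -- Counting by starting position: only the multiples of b + 1 contribute, each at most K.
  rw [Finset.sum_comm]
  calc ∑ j ∈ Finset.range W.length, ∑ i ∈ Q, (if f i <+: W.drop j then 1 else 0)
      ≤ ∑ j ∈ Finset.range W.length, if (b + 1) ∣ j then K else 0 := by
        refine Finset.sum_le_sum fun j _ => ?_
        rw [← Finset.card_filter]
        split_ifs with hj
        · exact hK _
        · rw [Nat.le_zero, Finset.card_eq_zero, Finset.filter_eq_empty_iff]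
          intro i hi h
          obtain ⟨x, hx⟩ := hf i hi
          exact hj (dvd_of_block_prefix (hx.trans h))
    _ ≤ L.length * K := by
        rw [← Finset.sum_filter, Finset.sum_const, smul_eq_mul, hW, length_flatMap_block]
        gcongr
        exact card_range_filter_dvd_le

theorem IsBlockString.length_eq {b m : ℕ} {s : Str} (h : IsBlockString b m s) :
    s.length = m * (b + 1) := by
  obtain ⟨L, rfl, rfl⟩ := h
  exact length_flatMap_block L

theorem IsBlockString.exists_block_prefix {b m : ℕ} {s : Str} (h : IsBlockString b m s)
    (hm : 0 < m) : ∃ x : Fin b → Bool, block x <+: s := by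
  obtain ⟨L, rfl, rfl⟩ := h
  obtain ⟨x, L, rfl⟩ := List.exists_cons_of_length_pos hm
  exact ⟨x, by simp⟩

theorem IsBlockString.append {b m m' : ℕ} {s t : Str} (hs : IsBlockString b m s)
    (ht : IsBlockString b m' t) : IsBlockString b (m + m') (s ++ t) := by
  obtain ⟨L, rfl, rfl⟩ := hs
  obtain ⟨L', rfl, rfl⟩ := ht
  exact ⟨L ++ L', by simp, by simp⟩

theorem isBlockString_block {b : ℕ} (x : Fin b → Bool) : IsBlockString b 1 (block x) :=
  ⟨[x], rfl, by simp⟩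

/-! ### Light edges -/

/-- The leaves and the branching nodes of `T` below `q`. -/
def forks (T : Finset Str) (q : Str) : Finset Str :=
  T.filter fun p => q <+: p ∧ (childSymbols T p).card ≠ 1

/-- The leaves of `T`. -/
def leaves (T : Finset Str) : Finset Str := T.filter fun p => (childSymbols T p).card = 0

theorem mem_childSymbols {T : Finset Str} {q : Str} {c : Option Bool} :
    c ∈ childSymbols T q ↔ q ++ [c] ∈ T := by
  simp [childSymbols]

/-- The two counts can differ only at the root, which is explicit even if it has a single child.
Leaving such a root out of `forks` is what permits the bound 2 · leaves - 1. -/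
theorem card_forks_eq_subtreeSize {T : Finset Str} {q : Str} (hq : q ≠ []) :
    (forks T q).card = subtreeSize T q := by
  rw [forks, subtreeSize, explicitNodes, Finset.filter_filter]
  congr 1
  refine Finset.filter_congr fun p _ => ?_
  have : q <+: p → p ≠ [] := fun h hp => hq (List.prefix_nil.1 (hp ▸ h))
  tauto

theorem forks_subset {T : Finset Str} {p q : Str} (h : p <+: q) : forks T q ⊆ forks T p :=
  fun _ hx => by
    rw [forks, Finset.mem_filter] at hx ⊢
    exact ⟨hx.1, h.trans hx.2.1, hx.2.2⟩

/-- A longest node below `q` is a leaf. -/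
theorem card_forks_pos {T : Finset Str} {q : Str} (hq : q ∈ T) : 0 < (forks T q).card := by
  obtain ⟨p, hp, hmax⟩ := Finset.exists_max_image (T.filter fun p => q <+: p) List.length
    ⟨q, Finset.mem_filter.2 ⟨hq, List.prefix_rfl⟩⟩
  rw [Finset.mem_filter] at hp
  refine Finset.card_pos.2 ⟨p, Finset.mem_filter.2 ⟨hp.1, hp.2, ?_⟩⟩
  rw [Finset.card_eq_zero.2 (Finset.eq_empty_of_forall_notMem fun c hc => ?_)]
  · exact zero_ne_one
  · have := hmax _ (Finset.mem_filter.2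
      ⟨mem_childSymbols.1 hc, hp.2.trans (List.prefix_append p [c])⟩)
    simp at this

/-- The heavy sibling has at least as many forks as the light child, the two subtrees are disjoint,
and `q` itself is a further fork because it branches. -/
theorem card_forks_light {hv : Finset Str → Str → Option Bool} (hhv : IsHeavyChoice hv)
    {T : Finset Str} {q : Str} (hq : q ∈ T) {c : Option Bool} (hc : c ∈ childSymbols T q)
    (hlight : c ≠ hv T q) : 2 * ((forks T (q ++ [c])).card + 1) ≤ (forks T q).card + 1 := by
  obtain ⟨hmem, hmax⟩ := hhv T q ⟨c, hc⟩
  have hle := hmax c hc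
  rw [← card_forks_eq_subtreeSize (by simp), ← card_forks_eq_subtreeSize (by simp)] at hle
  have hdisj : Disjoint (forks T (q ++ [c])) (forks T (q ++ [hv T q])) := by
    refine Finset.disjoint_left.2 fun p h1 h2 => hlight ?_
    have h := List.prefix_of_prefix_length_le (Finset.mem_filter.1 h1).2.1
      (Finset.mem_filter.1 h2).2.1 (by simp)
    simpa using h
  have hnot : q ∉ forks T (q ++ [c]) ∪ forks T (q ++ [hv T q]) := by
    simp only [Finset.mem_union, forks, Finset.mem_filter]
    rintro (h | h) <;> simpa using h.2.1.length_le
  have hsub : insert q (forks T (q ++ [c]) ∪ forks T (q ++ [hv T q])) ⊆ forks T q := by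
    refine Finset.insert_subset (Finset.mem_filter.2 ⟨hq, List.prefix_rfl, fun h => ?_⟩)
      (Finset.union_subset (forks_subset (List.prefix_append _ _))
        (forks_subset (List.prefix_append _ _)))
    exact hlight (Finset.card_le_one.1 h.le c hc _ hmem)
  have := Finset.card_le_card hsub
  rw [Finset.card_insert_of_notMem hnot, Finset.card_union_of_disjoint hdisj] at this
  omega

theorem isHead_concat {hv : Finset Str → Str → Option Bool} {T : Finset Str} {q : Str}
    {c : Option Bool} : IsHead hv T (q ++ [c]) ↔ c ≠ hv T q := by
  simp [IsHead]

/-- Potential argument: on the way down, a light edge doubles the power of two and at least halves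
the second factor, while a heavy edge adds no head and no forks. -/
theorem two_pow_card_heads_mul_le {hv : Finset Str → Str → Option Bool} (hhv : IsHeavyChoice hv)
    {T : Finset Str} (hT : ∀ q ∈ T, ∀ p, p <+: q → p ∈ T) (q : Str) (hq : q ∈ T) :
    2 ^ ((heads hv T).filter fun h => h ≠ [] ∧ h <+: q).card * ((forks T q).card + 1) ≤
      (forks T []).card + 1 := by
  classical
  induction q using List.reverseRecOn with
  | nil =>
    rw [Finset.filter_false_of_mem fun h _ hh => hh.1 (List.prefix_nil.1 hh.2)]
    simp
  | append_singleton q c ih =>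
    have hq' := hT _ hq q (List.prefix_append _ _)
    refine le_trans ?_ (ih hq')
    by_cases hc : c = hv T q
    · refine Nat.mul_le_mul (Nat.pow_le_pow_right (by norm_num) (Finset.card_le_card ?_))
        (Nat.succ_le_succ (Finset.card_le_card (forks_subset (List.prefix_append _ _))))
      intro h hh
      rw [Finset.mem_filter] at hh ⊢
      refine ⟨hh.1, hh.2.1, (List.prefix_concat_iff.1 hh.2.2).resolve_left ?_⟩
      rintro rfl
      exact isHead_concat.1 (Finset.mem_filter.1 hh.1).2 hc
    · calc _ ≤ 2 ^ (((heads hv T).filter fun h => h ≠ [] ∧ h <+: q).card + 1) *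
            ((forks T (q ++ [c])).card + 1) := by
            gcongr
            · norm_num
            · refine (Finset.card_le_card fun h hh => ?_).trans
                (Finset.card_insert_le (q ++ [c]) _)
              rw [Finset.mem_filter] at hh
              rw [Finset.mem_insert, Finset.mem_filter]
              exact (List.prefix_concat_iff.1 hh.2.2).imp_right fun h' => ⟨hh.1, hh.2.1, h'⟩
        _ ≤ _ := by
            rw [pow_succ, mul_assoc]
            gcongr
            exact card_forks_light hhv hq' (mem_childSymbols.2 hq) hc

/-- Every node except the root is counted once, at its parent. -/
theorem sum_card_childSymbols {T : Finset Str} (h0 : [] ∈ T)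
    (hT : ∀ q ∈ T, ∀ p, p <+: q → p ∈ T) :
    ∑ q ∈ T, (childSymbols T q).card + 1 = T.card := by
  rw [← Finset.card_erase_add_one h0, Nat.add_right_cancel_iff, eq_comm,
    Finset.card_eq_sum_card_fiberwise (f := List.dropLast) (t := T)
      fun q hq => hT q (Finset.mem_of_mem_erase hq) _ (List.dropLast_prefix q)]
  refine Finset.sum_congr rfl fun q _ => ?_
  rw [← Finset.card_image_of_injective (childSymbols T q) (f := fun c => q ++ [c])
    fun c c' h => by simpa using h]
  congr 1
  ext p
  simp only [Finset.mem_filter, Finset.mem_erase, Finset.mem_image, mem_childSymbols]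
  constructor
  · rintro ⟨⟨hp, hpT⟩, rfl⟩
    exact ⟨p.getLast hp, by rwa [List.dropLast_append_getLast], List.dropLast_append_getLast hp⟩
  · rintro ⟨c, hc, rfl⟩
    exact ⟨⟨by simp, hc⟩, by simp⟩

theorem card_forks_add_one_le {T : Finset Str} (h0 : [] ∈ T)
    (hT : ∀ q ∈ T, ∀ p, p <+: q → p ∈ T) :
    (forks T []).card + 1 ≤ 2 * (leaves T).card := by
  -- Node by node, with c children: 1 + [c ≠ 1] ≤ c + 2 [c = 0].
  have h1 : T.card + (forks T []).card ≤
      ∑ q ∈ T, (childSymbols T q).card + 2 * (leaves T).card := by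
    rw [forks, leaves, Finset.card_filter, Finset.card_filter, Finset.card_eq_sum_ones,
      Finset.mul_sum, ← Finset.sum_add_distrib, ← Finset.sum_add_distrib]
    refine Finset.sum_le_sum fun q _ => ?_
    simp only [List.nil_prefix, true_and]
    split_ifs <;> omega
  have := sum_card_childSymbols h0 hT
  omega

/-- The heavy-light decomposition: a string meets few heavy paths. -/
theorem card_heads_prefix_le {hv : Finset Str → Str → Option Bool} (hhv : IsHeavyChoice hv)
    {T : Finset Str} (h0 : [] ∈ T) (hT : ∀ q ∈ T, ∀ p, p <+: q → p ∈ T) (V : Str) :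
    ((heads hv T).filter fun h => h <+: V).card ≤ Nat.log 2 (2 * (leaves T).card) := by
  classical
  -- The string `V` may leave the tree; every head that is a prefix of `V` is also a prefix of its
  -- longest prefix in `T`.
  obtain ⟨q, hq, hmax⟩ := Finset.exists_max_image (T.filter fun p => p <+: V) List.length
    ⟨[], Finset.mem_filter.2 ⟨h0, List.nil_prefix⟩⟩
  rw [Finset.mem_filter] at hq
  have h1 := two_pow_card_heads_mul_le hhv hT q hq.1
  have h2 : ((heads hv T).filter fun h => h <+: V).card ≤
      ((heads hv T).filter fun h => h ≠ [] ∧ h <+: q).card + 1 := by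
    refine (Finset.card_le_card fun h hh => ?_).trans (Finset.card_insert_le [] _)
    rw [Finset.mem_filter] at hh
    rw [Finset.mem_insert, Finset.mem_filter]
    by_cases hnil : h = []
    · exact .inl hnil
    · exact .inr ⟨hh.1, hnil, List.prefix_of_prefix_length_le hh.2 hq.2
        (hmax h (Finset.mem_filter.2 ⟨(Finset.mem_filter.1 hh.1).1, hh.2⟩))⟩
  have hpos := card_forks_pos hq.1
  have h3 := card_forks_add_one_le h0 hT
  -- The root path costs one more factor 2, which is paid for by `(forks T q).card + 1 ≥ 2`.
  have hle : 2 ^ ((heads hv T).filter fun h => h <+: V).card ≤ 2 * (leaves T).card := by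
    calc _ ≤ 2 ^ (((heads hv T).filter fun h => h ≠ [] ∧ h <+: q).card + 1) :=
          Nat.pow_le_pow_right (by norm_num) h2
      _ ≤ 2 ^ ((heads hv T).filter fun h => h ≠ [] ∧ h <+: q).card * ((forks T q).card + 1) := by
          rw [pow_succ]; gcongr; omega
      _ ≤ _ := h1.trans h3
  exact Nat.le_log_of_pow_le (by norm_num) hle

/-! ### Sparse suffix trees of block strings -/

theorem nil_mem_sparseSuffixTree (r : ℕ) (C : Finset Str) : [] ∈ sparseSuffixTree r C :=
  Finset.mem_insert_self _ _

theorem mem_sparseSuffixTree {r : ℕ} {C : Finset Str} {q : Str} :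
    q ∈ sparseSuffixTree r C ↔ q = [] ∨ ∃ x ∈ spacedSuffixes r C, q <+: x := by
  simp [sparseSuffixTree]

theorem mem_spacedSuffixes {r : ℕ} {C : Finset Str} {x : Str} :
    x ∈ spacedSuffixes r C ↔ ∃ s ∈ C, ∃ j, j < s.length ∧ r ∣ j ∧ s.drop j = x := by
  simp [spacedSuffixes, and_assoc]

theorem mem_sparseSuffixTree_of_prefix {r : ℕ} {C : Finset Str} :
    ∀ q ∈ sparseSuffixTree r C, ∀ p, p <+: q → p ∈ sparseSuffixTree r C := by
  intro q hq p hp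
  rw [mem_sparseSuffixTree] at hq ⊢
  rcases hq with rfl | ⟨x, hx, hqx⟩
  · exact .inl (List.prefix_nil.1 hp)
  · exact .inr ⟨x, hx, hp.trans hqx⟩

/-- A leaf cannot be a proper prefix of a spaced suffix, so it is one itself, and a string of length
m * r has at most m of these. For empty `C` this fails: the root is then a leaf. -/
theorem card_leaves_le {r m : ℕ} {C : Finset Str} (hC : C.Nonempty)
    (hlen : ∀ s ∈ C, s.length = m * r) (hpos : 0 < m * r) :
    (leaves (sparseSuffixTree r C)).card ≤ C.card * m := by
  have hext : ∀ q x, x ∈ spacedSuffixes r C → q <+: x →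
      (childSymbols (sparseSuffixTree r C) q).card = 0 → q = x := by
    rintro q x hx ⟨t, rfl⟩ h
    cases t with
    | nil => simp
    | cons c t =>
      refine absurd (Finset.card_eq_zero.1 h) (Finset.ne_empty_of_mem (a := c) ?_)
      rw [mem_childSymbols, mem_sparseSuffixTree]
      exact .inr ⟨_, hx, by simp⟩
  have hsub : leaves (sparseSuffixTree r C) ⊆ spacedSuffixes r C := by
    intro q hq
    rw [leaves, Finset.mem_filter, mem_sparseSuffixTree] at hq
    obtain ⟨rfl | ⟨x, hx, hqx⟩, h⟩ := hq
    · obtain ⟨s, hs⟩ := hC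
      have hsmem : s ∈ spacedSuffixes r C :=
        mem_spacedSuffixes.2 ⟨s, hs, 0, by rw [hlen s hs]; exact hpos, by simp, by simp⟩
      rwa [hext [] s hsmem List.nil_prefix h]
    · rwa [hext q x hx hqx h]
  refine (Finset.card_le_card hsub).trans (Finset.card_biUnion_le_card_mul _ _ _ fun s hs => ?_)
  rw [hlen s hs]
  exact Finset.card_image_le.trans card_range_filter_dvd_le

theorem sum_occ_heads_le {hv : Finset Str → Str → Option Bool} (hhv : IsHeavyChoice hv)
    {b m : ℕ} (hm : 0 < m) {C : Finset Str} (hC : ∀ s ∈ C, IsBlockString b m s)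
    (L : List (Fin b → Bool)) :
    ∑ s ∈ C, ∑ h ∈ heads hv (sparseSuffixTree (b + 1) C), occ (s ++ h) (L.flatMap block) ≤
      L.length * Nat.log 2 (2 * (C.card * m)) := by
  rcases C.eq_empty_or_nonempty with rfl | hne
  · simp
  rw [← Finset.sum_product' (f := fun s h => occ (s ++ h) (L.flatMap block))]
  refine sum_occ_le _ (fun i : Str × Str => i.1 ++ i.2) _ (fun i hi => ?_) (fun V => ?_) L
  · obtain ⟨x, hx⟩ := (hC i.1 (Finset.mem_product.1 hi).1).exists_block_prefix hm
    exact ⟨x, hx.trans (List.prefix_append _ _)⟩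
  · calc _ ≤ ((heads hv (sparseSuffixTree (b + 1) C)).filter
            fun h => h <+: V.drop (m * (b + 1))).card := by
          refine Finset.card_le_card_of_injOn Prod.snd (fun i hi => ?_) fun i hi i' hi' h => ?_
          · rw [Finset.mem_coe, Finset.mem_filter, Finset.mem_product] at hi
            obtain ⟨⟨hs, hh⟩, t, rfl⟩ := hi
            refine Finset.mem_filter.2 ⟨hh, ?_⟩
            rw [← (hC _ hs).length_eq, List.append_assoc, List.drop_left]
            exact List.prefix_append _ _
          · rw [Finset.mem_coe, Finset.mem_filter, Finset.mem_product] at hi hi'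
            refine Prod.ext ?_ h
            have h1 := (hC _ hi.1.1).length_eq
            have h2 := (hC _ hi'.1.1).length_eq
            have h3 := List.prefix_of_prefix_length_le
              ((List.prefix_append i.1 i.2).trans hi.2) ((List.prefix_append i'.1 i'.2).trans hi'.2)
              (by rw [h1, h2])
            exact h3.eq_of_length (by rw [h1, h2])
      _ ≤ _ := by
          refine (card_heads_prefix_le hhv (nil_mem_sparseSuffixTree _ _)
            mem_sparseSuffixTree_of_prefix _).trans (Nat.log_mono_right ?_)
          gcongr
          exact card_leaves_le hne (fun s hs => (hC s hs).length_eq) (by positivity)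

/-! ### The dyadic intervals used by the binary tree mechanism -/

/-- The dyadic nodes that are used in the answers to the first `N` queries. -/
def usedNodes (N : ℕ) : Finset (ℕ × ℕ) := (Finset.range (N + 1)).biUnion dyadicNodes

theorem dyadicNodes_subset_usedNodes {t N : ℕ} (h : t ≤ N) : dyadicNodes t ⊆ usedNodes N :=
  Finset.subset_biUnion_of_mem dyadicNodes (Finset.mem_range.2 (Nat.lt_succ_of_le h))

theorem usedNodes_bounds {N : ℕ} {I : ℕ × ℕ} (hI : I ∈ usedNodes N) :
    2 ^ I.1 ≤ N ∧ (I.2 + 1) * 2 ^ I.1 ≤ N := by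
  simp only [usedNodes, dyadicNodes, Finset.mem_biUnion, Finset.mem_range, Finset.mem_image,
    Finset.mem_filter] at hI
  obtain ⟨t, ht, a, ⟨-, hbit⟩, rfl⟩ := hI
  refine ⟨(Nat.ge_two_pow_of_testBit hbit).trans (Nat.lt_succ_iff.1 ht), ?_⟩
  have h1 : t / 2 ^ a % 2 = 1 := by
    simpa [Nat.testBit_eq_decide_div_mod_eq] using hbit
  -- As bit a of t is 1, the interval ends at ⌊t / 2^a⌋ 2^a ≤ t.
  have h2 : 2 * (t / 2 ^ (a + 1)) + 1 = t / 2 ^ a := by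
    rw [pow_succ, ← Nat.div_div_eq_div_mul]
    omega
  rw [h2]
  exact (Nat.div_mul_le_self _ _).trans (Nat.lt_succ_iff.1 ht)

/-- The intervals of one level are disjoint, so a position lies in at most one per level, and only
levels a with 2^a ≤ N occur. -/
theorem sum_usedNodes_abs_le (N : ℕ) (y : ℕ → ℝ) :
    ∑ I ∈ usedNodes N, |∑ i ∈ Finset.Ico (I.2 * 2 ^ I.1) ((I.2 + 1) * 2 ^ I.1), y i| ≤
      (Nat.log 2 N + 1 : ℕ) * ∑ j ∈ Finset.range N, |y j| := by
  calc _ ≤ ∑ I ∈ usedNodes N, ∑ j ∈ Finset.range N,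
        if j ∈ Finset.Ico (I.2 * 2 ^ I.1) ((I.2 + 1) * 2 ^ I.1) then |y j| else 0 := by
        refine Finset.sum_le_sum fun I hI => (Finset.abs_sum_le_sum_abs _ _).trans_eq ?_
        rw [← Finset.sum_filter]
        refine Finset.sum_congr ?_ fun _ _ => rfl
        ext j
        have := (usedNodes_bounds hI).2
        simp only [Finset.mem_filter, Finset.mem_range, Finset.mem_Ico]
        omega
    _ = ∑ j ∈ Finset.range N, ((usedNodes N).filter fun I =>
          j ∈ Finset.Ico (I.2 * 2 ^ I.1) ((I.2 + 1) * 2 ^ I.1)).card * |y j| := by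
        rw [Finset.sum_comm]
        refine Finset.sum_congr rfl fun j _ => ?_
        rw [← Finset.sum_filter, Finset.sum_const, nsmul_eq_mul]
    _ ≤ _ := by
        rw [Finset.mul_sum]
        gcongr with j hj
        refine (Finset.card_le_card_of_injOn Prod.fst (t := Finset.range (Nat.log 2 N + 1))
          (fun I hI => ?_) fun I hI I' hI' h => ?_).trans_eq (Finset.card_range _)
        · rw [Finset.mem_coe, Finset.mem_filter] at hI
          exact Finset.mem_range.2 (Nat.lt_succ_of_le
            (Nat.le_log_of_pow_le (by norm_num) (usedNodes_bounds hI.1).1))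
        · have key : ∀ I : ℕ × ℕ, j ∈ Finset.Ico (I.2 * 2 ^ I.1) ((I.2 + 1) * 2 ^ I.1) →
              I.2 = j / 2 ^ I.1 := fun I h => by
            rw [Finset.mem_Ico] at h
            exact (Nat.div_eq_of_lt_le h.1 h.2).symm
          rw [Finset.mem_coe, Finset.mem_filter] at hI hI'
          refine Prod.ext h ?_
          rw [key I hI.2, key I' hI'.2, h]

/-- The binary tree mechanism on another stream, with shifted noise. -/
theorem treeQuery_eq_shift (x x' : ℕ → ℝ) (z : ℕ × ℕ → ℝ) (t : ℕ) :
    treeQuery x z t = treeQuery x' (fun I => z I +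
      ∑ i ∈ Finset.Ico (I.2 * 2 ^ I.1) ((I.2 + 1) * 2 ^ I.1), (x i - x' i)) t := by
  refine Finset.sum_congr rfl fun I _ => ?_
  rw [dyadicCount, dyadicCount, Finset.sum_sub_distrib]
  ring

theorem treeQuery_congr {x : ℕ → ℝ} {z z' : ℕ × ℕ → ℝ} {t : ℕ}
    (h : ∀ I ∈ dyadicNodes t, z I = z' I) : treeQuery x z t = treeQuery x z' t :=
  Finset.sum_congr rfl fun I hI => by rw [dyadicCount, dyadicCount, h I hI]

/-! ### Increments of antitone sequences -/

/-- The difference sequence `g 0, g 1 - g 0, g 2 - g 1, …`. -/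
def increments (g : ℕ → ℝ) : ℕ → ℝ
  | 0 => g 0
  | j + 1 => g (j + 1) - g j

/-- The decrements telescope: g 0 + (g 0 - g (N - 1)) for N ≥ 1. -/
theorem sum_abs_increments_le {g : ℕ → ℝ} (hg : Antitone g) (h0 : ∀ j, 0 ≤ g j) (N : ℕ) :
    ∑ j ∈ Finset.range N, |increments g j| ≤ 2 * g 0 := by
  cases N with
  | zero => simpa using h0 0
  | succ N =>
    have h : ∀ j, |increments g (j + 1)| = g j - g (j + 1) := fun j => by
      rw [increments, abs_sub_comm, abs_of_nonneg (sub_nonneg.2 (hg j.le_succ))]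
    rw [Finset.sum_range_succ', Finset.sum_congr rfl fun j _ => h j, Finset.sum_range_sub',
      increments, abs_of_nonneg (h0 0)]
    linarith [h0 N]

theorem pathNode_prefix (hv : Finset Str → Str → Option Bool) (T : Finset Str) (h : Str) :
    ∀ j, h <+: pathNode hv T h j
  | 0 => List.prefix_rfl
  | j + 1 => (pathNode_prefix hv T h j).trans (List.prefix_append _ _)

theorem headOf_mem_heads {hv : Finset Str → Str → Option Bool} {T : Finset Str}
    (hT : ∀ q ∈ T, ∀ p, p <+: q → p ∈ T) {q : Str} (hq : q ∈ T) :
    headOf hv T q ∈ heads hv T := by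
  classical
  refine Finset.mem_filter.2 ⟨hT q hq _ (List.take_prefix _ _), ?_⟩
  -- The default value 0 of `Nat.findGreatest` is a genuine solution, because the empty prefix is a
  -- head.
  exact Nat.findGreatest_spec (P := fun j => IsHead hv T (q.take j)) (m := 0) (Nat.zero_le _)
    (.inl (List.take_zero))

/-! ### Elementary facts about the algorithm -/

namespace Params

variable {A : Type*} [Fintype A] (p : Params A)

theorem Neighbor.symm {D D' : p.Dataset} (h : p.Neighbor D D') : p.Neighbor D' D := by
  obtain ⟨i, hi, h⟩ := h
  exact ⟨i, hi.symm, fun j hj => (h j hj).symm⟩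

/-- The code word of a symbol. -/
def codeWord (a : A) : Fin p.bits → Bool := p.code a

theorem encode_eq (S : List A) : p.encode S = (S.map p.codeWord).flatMap block :=
  (List.flatMap_map _ _ _).symm

/-- All other users cancel. This is the only way in which the neighbouring relation enters the
sensitivity bounds. -/
theorem exists_freq_sub_eq {D D' : p.Dataset} (h : p.Neighbor D D') :
    ∃ L L' : List (Fin p.bits → Bool), L.length ≤ p.len ∧ L'.length ≤ p.len ∧
      ∀ P, p.freq D P - p.freq D' P = occ P (L.flatMap block) - occ P (L'.flatMap block) := by
  obtain ⟨i, -, h⟩ := h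
  refine ⟨(D i).1.map p.codeWord, (D' i).1.map p.codeWord,
    by simpa using (D i).2.2, by simpa using (D' i).2.2, fun P => ?_⟩
  rw [← p.encode_eq, ← p.encode_eq, freq, freq, ← Finset.sum_sub_distrib,
    Finset.sum_eq_single i (fun j _ hj => by rw [h j hj, sub_self]) (by simp)]

theorem diffVec_eq_increments (D : p.Dataset) (T : Finset Str) (s h : Str) :
    p.diffVec D T s h = increments fun j => p.freq D (s ++ pathNode p.hv T h j) := by
  funext j
  cases j <;> rfl

/-- Sensitivity of the difference vectors. -/
theorem sum_abs_diffVec_sub_le (hhv : IsHeavyChoice p.hv) {m : ℕ} (hm : 0 < m) {C : Finset Str}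
    (hC : ∀ s ∈ C, IsBlockString p.bits m s) {D D' : p.Dataset} (h : p.Neighbor D D')
    (N : Str → ℕ) :
    ∑ s ∈ C, ∑ h ∈ heads p.hv (sparseSuffixTree p.r C), ∑ j ∈ Finset.range (N h),
        |p.diffVec D (sparseSuffixTree p.r C) s h j -
          p.diffVec D' (sparseSuffixTree p.r C) s h j| ≤
      4 * p.len * Nat.log 2 (2 * (C.card * m)) := by
  obtain ⟨L, L', hL, hL', hfreq⟩ := p.exists_freq_sub_eq h
  set T := sparseSuffixTree p.r C with hT
  set K := Nat.log 2 (2 * (C.card * m)) with hK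
  have key : ∀ s h, ∑ j ∈ Finset.range (N h), |p.diffVec D T s h j - p.diffVec D' T s h j| ≤
      2 * (occ (s ++ h) (L.flatMap block) : ℝ) + 2 * (occ (s ++ h) (L'.flatMap block) : ℝ) := by
    intro s h
    -- Beyond the end of a heavy path `pathNode` still appends symbols and the counts stay antitone,
    -- so the lengths `N h` may be arbitrary.
    let g : Str → ℕ → ℝ := fun W j => occ (s ++ pathNode p.hv T h j) W
    have hg : ∀ W, Antitone (g W) := fun W => antitone_nat_of_succ_le fun j =>
      Nat.cast_le.2 (occ_anti ((List.prefix_append_right_inj s).2 (List.prefix_append _ _)) W)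
    have hdiff : ∀ j, p.diffVec D T s h j - p.diffVec D' T s h j =
        increments (g (L.flatMap block)) j - increments (g (L'.flatMap block)) j := by
      intro j
      rw [diffVec_eq_increments, diffVec_eq_increments]
      cases j with
      | zero => exact hfreq _
      | succ j =>
        have h1 := hfreq (s ++ pathNode p.hv T h (j + 1))
        have h2 := hfreq (s ++ pathNode p.hv T h j)
        simp only [increments, g]
        linarith
    calc _ ≤ ∑ j ∈ Finset.range (N h), (|increments (g (L.flatMap block)) j| +
            |increments (g (L'.flatMap block)) j|) :=
          Finset.sum_le_sum fun j _ => by rw [hdiff]; exact abs_sub _ _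
      _ ≤ _ := by
          rw [Finset.sum_add_distrib]
          exact add_le_add (sum_abs_increments_le (hg _) (fun j => Nat.cast_nonneg _) _)
            (sum_abs_increments_le (hg _) (fun j => Nat.cast_nonneg _) _)
  have hocc : ∀ L : List (Fin p.bits → Bool), L.length ≤ p.len →
      ∑ s ∈ C, ∑ h ∈ heads p.hv T, (occ (s ++ h) (L.flatMap block) : ℝ) ≤ p.len * K := by
    intro L hL
    exact_mod_cast (sum_occ_heads_le hhv hm hC L).trans (Nat.mul_le_mul_right _ hL)
  calc _ ≤ ∑ s ∈ C, ∑ h ∈ heads p.hv T, (2 * (occ (s ++ h) (L.flatMap block) : ℝ) +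
          2 * (occ (s ++ h) (L'.flatMap block) : ℝ)) :=
        Finset.sum_le_sum fun s _ => Finset.sum_le_sum fun h _ => key s h
    _ = 2 * (∑ s ∈ C, ∑ h ∈ heads p.hv T, (occ (s ++ h) (L.flatMap block) : ℝ)) +
          2 * ∑ s ∈ C, ∑ h ∈ heads p.hv T, (occ (s ++ h) (L'.flatMap block) : ℝ) := by
        simp only [Finset.mul_sum, Finset.sum_add_distrib]
    _ ≤ 4 * p.len * K := by linarith [hocc L hL, hocc L' hL']

/-! ### The first phase -/

/-- At most one block can occur at a given position, so each of the two strings contributes at most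
its number of blocks. -/
theorem sum_abs_freq_block_sub_le {D D' : p.Dataset} (h : p.Neighbor D D') :
    ∑ x : Fin p.bits → Bool, |p.freq D (block x) - p.freq D' (block x)| ≤ 2 * p.len := by
  obtain ⟨L, L', hL, hL', hfreq⟩ := p.exists_freq_sub_eq h
  have hocc : ∀ L : List (Fin p.bits → Bool), L.length ≤ p.len →
      ∑ x : Fin p.bits → Bool, (occ (block x) (L.flatMap block) : ℝ) ≤ p.len := by
    intro L hL
    have h := sum_occ_le (b := p.bits) Finset.univ block 1 (fun x _ => ⟨x, List.prefix_rfl⟩)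
      (fun V => Finset.card_le_one.2 fun x hx y hy => block_injective
        ((List.prefix_of_prefix_length_le (Finset.mem_filter.1 hx).2 (Finset.mem_filter.1 hy).2
          (by rw [length_block, length_block])).eq_of_length
            (by rw [length_block, length_block]))) L
    rw [mul_one] at h
    exact_mod_cast h.trans hL
  calc _ ≤ ∑ x : Fin p.bits → Bool, ((occ (block x) (L.flatMap block) : ℝ) +
          occ (block x) (L'.flatMap block)) := by
        refine Finset.sum_le_sum fun x _ => ?_
        rw [hfreq]
        refine (abs_sub _ _).trans_eq ?_
        rw [Nat.abs_cast, Nat.abs_cast]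
    _ ≤ 2 * p.len := by
        rw [Finset.sum_add_distrib]
        linarith [hocc L hL, hocc L' hL']

theorem measurable_firstPhase (D : p.Dataset) : Measurable fun z : (Fin p.bits → Bool) → ℝ =>
    (Finset.univ.filter fun x => p.τ < p.freq D (block x) + z x).image block := by
  have h : ∀ z : (Fin p.bits → Bool) → ℝ,
      (Finset.univ.filter fun x => p.τ < p.freq D (block x) + z x).image block =
        Finset.univ.biUnion fun x : Fin p.bits → Bool =>
          if p.τ < p.freq D (block x) + z x then {block x} else ∅ := by
    intro z
    ext w
    simp only [Finset.mem_image, Finset.mem_filter, Finset.mem_univ, true_and,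
      Finset.mem_biUnion]
    refine exists_congr fun x => ?_
    split_ifs with hx <;> simp [hx, eq_comm]
  simp only [h]
  exact measurable_biUnion _ fun x _ => Measurable.ite
    (measurableSet_lt measurable_const (by fun_prop)) measurable_const measurable_const

theorem isDP_firstPhase (hlen : 2 ≤ p.len) (hε : 0 < p.ε) (hlam : 0 < p.lam) :
    IsDP p.Neighbor (p.ε / p.lam) p.firstPhase := by
  have hb : 0 < 2 * p.len * p.lam / p.ε := by
    have : (0 : ℝ) < p.len := by exact_mod_cast (by omega : 0 < p.len)
    positivity
  have := isProbabilityMeasure_laplace hb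
  refine isDP_of_le (fun _ _ => Neighbor.symm p) (fun D => ?_) fun D D' h => ?_
  · exact Measure.isProbabilityMeasure_map (p.measurable_firstPhase D).aemeasurable
  · refine map_pi_laplace_le hb (p.measurable_firstPhase D')
      (fun x => p.freq D (block x) - p.freq D' (block x)) (fun z => ?_) ?_
    · congr 1
      refine Finset.filter_congr fun x _ => ?_
      rw [show p.freq D (block x) + z x =
        p.freq D' (block x) + (z x + (p.freq D (block x) - p.freq D' (block x))) by ring]
    · refine (p.sum_abs_freq_block_sub_le h).trans_eq ?_
      field_simp

/-! ### The depth-first search -/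

theorem search_subset {T : Finset Str} {count : Str → ℝ} {τ : ℝ} :
    ∀ {fuel : ℕ} {q : Str}, q ∈ T → search T count τ fuel q ⊆ T
  | 0, _, _ => Finset.empty_subset _
  | fuel + 1, q, hq => by
    rw [search]
    split_ifs
    · exact Finset.insert_subset hq (Finset.biUnion_subset.2 fun c hc =>
        search_subset (mem_childSymbols.1 hc))
    · exact Finset.empty_subset _

/-- The search sees the data only through the counts, at nodes within the depth limit; this makes it
post-processing. -/
theorem search_congr {T : Finset Str} {count count' : Str → ℝ} {τ : ℝ} :
    ∀ {fuel : ℕ} {q : Str}, q ∈ T →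
      (∀ q' ∈ T, q'.length < q.length + fuel → count q' = count' q') →
      search T count τ fuel q = search T count' τ fuel q
  | 0, _, _, _ => rfl
  | fuel + 1, q, hq, h => by
    rw [search, search, h q hq (by omega)]
    congr 2
    refine Finset.biUnion_congr rfl fun c hc => search_congr (mem_childSymbols.1 hc) ?_
    intro q' hq' hlt
    refine h q' hq' ?_
    rw [List.length_append, List.length_singleton] at hlt
    omega

theorem measurable_search {Ω : Type*} [MeasurableSpace Ω] {T : Finset Str} {τ : ℝ}
    {count : Ω → Str → ℝ} (h : ∀ q, Measurable fun ω => count ω q) :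
    ∀ (fuel : ℕ) (q : Str), Measurable fun ω => search T (count ω) τ fuel q
  | 0, _ => measurable_const
  | fuel + 1, q => by
    simp only [search]
    refine Measurable.ite (measurableSet_lt measurable_const (h q)) ?_ measurable_const
    exact (Measurable.of_discrete (f := fun s : Finset Str => insert q s)).comp
      (measurable_biUnion _ fun c _ => measurable_search h fuel (q ++ [c]))

theorem measurable_noisyCount (D : p.Dataset) (T : Finset Str) (s q : Str) :
    Measurable fun z => p.noisyCount D T z s q := by
  simp only [noisyCount, treeQuery, dyadicCount]
  fun_prop

theorem measurable_extend (k : ℕ) (C : Finset Str) (D : p.Dataset) :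
    Measurable (p.extend k C D) := by
  refine measurable_biUnion C fun s _ => ?_
  exact (Measurable.of_discrete (f := fun N : Finset Str => N.image fun q => s ++ q)).comp
    (measurable_search (p.measurable_noisyCount D _ s) _ _)

theorem extend_congr {k : ℕ} {C : Finset Str} {D D' : p.Dataset} {z z' : Str × (ℕ × ℕ) → ℝ}
    (h : ∀ s ∈ C, ∀ q ∈ sparseSuffixTree p.r C, q.length ≤ k →
      p.noisyCount D (sparseSuffixTree p.r C) z s q =
        p.noisyCount D' (sparseSuffixTree p.r C) z' s q) :
    p.extend k C D z = p.extend k C D' z' := by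
  refine Finset.biUnion_congr rfl fun s hs => congrArg _ ?_
  refine search_congr (nil_mem_sparseSuffixTree _ _) fun q hq hlt => h s hs q hq ?_
  rw [List.length_nil] at hlt
  omega

/-- The tree also contains proper suffixes, but these are too short to give length 2k. At that
length `q` is a whole string of `C`. -/
theorem isBlockString_of_mem_extend {m : ℕ} (hm : 0 < m) {C : Finset Str}
    (hC : ∀ s ∈ C, IsBlockString p.bits m s) {k : ℕ} {D : p.Dataset} {z : Str × (ℕ × ℕ) → ℝ}
    {w : Str} (hw : w ∈ p.extend k C D z) :
    w.length ≤ p.r * (m * 2) ∧ (w.length = p.r * (m * 2) → IsBlockString p.bits (m * 2) w) := by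
  simp only [extend, Finset.mem_biUnion, Finset.mem_image] at hw
  obtain ⟨s, hs, q, hq, rfl⟩ := hw
  have hlen : ∀ s ∈ C, s.length = p.r * m := fun s hs => by
    rw [(hC s hs).length_eq, mul_comm]; rfl
  have hpos : 0 < p.r * m := Nat.mul_pos (Nat.succ_pos _) hm
  have hq := search_subset (nil_mem_sparseSuffixTree _ _) hq
  rw [List.length_append, hlen s hs, ← mul_assoc, mul_two]
  rcases mem_sparseSuffixTree.1 hq with rfl | ⟨x, hx, hqx⟩
  · rw [List.length_nil]
    omega
  obtain ⟨s', hs', j, hj, -, rfl⟩ := mem_spacedSuffixes.1 hx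
  have hle := hqx.length_le
  rw [List.length_drop, hlen s' hs'] at hle
  refine ⟨by omega, fun heq => ?_⟩
  obtain rfl : j = 0 := by
    rw [hlen s' hs'] at hj
    omega
  obtain rfl : q = s' := hqx.eq_of_length (by rw [List.drop_zero, hlen s' hs']; omega)
  rw [mul_two]
  exact (hC s hs).append (hC q hs')

/-! ### Numerical bounds -/

/-- Squaring reduces it to 2^3 ≤ 3^2. -/
theorem three_halves_le_logb_three : (3 / 2 : ℝ) ≤ Real.logb 2 3 := by
  rw [Real.le_logb_iff_rpow_le one_lt_two (by norm_num)]
  refine le_of_sq_le_sq ?_ (by norm_num)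
  rw [← Real.rpow_natCast, ← Real.rpow_mul (by norm_num)]
  norm_num

theorem two_mul_sub_one_le {ℓ : ℕ} (h : 2 ≤ ℓ) : 2 * ((ℓ : ℝ) - 1) ≤ Real.logb 2 ℓ * ℓ := by
  have h2 : (2 : ℝ) ≤ ℓ := by exact_mod_cast h
  rcases Nat.lt_or_ge ℓ 4 with h4 | h4
  · interval_cases ℓ
    · norm_num
    · push_cast
      linarith [three_halves_le_logb_three]
  · have : (2 : ℝ) ≤ Real.logb 2 ℓ := by
      rw [Real.le_logb_iff_rpow_le one_lt_two (by linarith)]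
      norm_num
      exact_mod_cast h4
    nlinarith

theorem len_le_lenBit : p.len ≤ p.lenBit := Nat.le_mul_of_pos_right _ (Nat.succ_pos _)

theorem one_le_logb_two {x : ℝ} (h : 2 ≤ x) : 1 ≤ Real.logb 2 x := by
  rwa [Real.le_logb_iff_rpow_le one_lt_two (by linarith), Real.rpow_one]

theorem one_le_logb_lenBit (hlen : 2 ≤ p.len) : 1 ≤ Real.logb 2 p.lenBit :=
  one_le_logb_two (by exact_mod_cast hlen.trans p.len_le_lenBit)

theorem one_le_logb_mul_lenBit (hn : 1 ≤ p.n) (hlen : 2 ≤ p.len) :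
    1 ≤ Real.logb 2 (p.n * p.lenBit) :=
  one_le_logb_two (by
    exact_mod_cast (hlen.trans p.len_le_lenBit).trans (Nat.le_mul_of_pos_left _ hn))

/-- It suffices that 2cm ≤ n ℓ_bit. The termination test gives c log₂ ℓ_bit ≤ n, and 2m ≤ 2(ℓ - 1) ≤
ℓ log₂ ℓ ≤ ℓ_bit log₂ ℓ_bit. -/
theorem natLog_le_logb_mul_lenBit (hn : 1 ≤ p.n) (hlen : 2 ≤ p.len) {m c : ℕ} (hm0 : 0 < m)
    (hm : m < p.len) (hc : (c : ℝ) ≤ p.n / Real.logb 2 p.lenBit) :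
    (Nat.log 2 (2 * (c * m)) : ℝ) ≤ Real.logb 2 (p.n * p.lenBit) := by
  rcases Nat.eq_zero_or_pos c with rfl | hc0
  · simpa using zero_le_one.trans (p.one_le_logb_mul_lenBit hn hlen)
  have hX := p.one_le_logb_lenBit hlen
  have hX0 : Real.logb 2 p.len ≤ Real.logb 2 p.lenBit :=
    Real.logb_le_logb_of_le one_lt_two (by exact_mod_cast (by omega : 0 < p.len))
      (by exact_mod_cast p.len_le_lenBit)
  have h1 : 2 * (m : ℝ) ≤ Real.logb 2 p.lenBit * p.lenBit := by
    calc 2 * (m : ℝ) ≤ 2 * ((p.len : ℝ) - 1) := by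
          have : (m : ℝ) + 1 ≤ p.len := by exact_mod_cast hm
          linarith
      _ ≤ Real.logb 2 p.len * p.len := two_mul_sub_one_le hlen
      _ ≤ _ := by
          gcongr
          exact p.len_le_lenBit
  rw [le_div_iff₀ (by linarith)] at hc
  refine (Real.natLog_le_logb _ _).trans (Real.logb_le_logb_of_le (by norm_num)
    (by positivity) ?_)
  push_cast
  calc (2 : ℝ) * (c * m) = c * (2 * m) := by ring
    _ ≤ c * (Real.logb 2 p.lenBit * p.lenBit) := by gcongr
    _ = c * Real.logb 2 p.lenBit * p.lenBit := by ring
    _ ≤ _ := by gcongr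

/-- The number of levels of the binary tree mechanisms, times the number of heavy paths that meet
a string, is covered by the calibration of the noise. -/
theorem levels_mul_natLog_le (hn : 1 ≤ p.n) (hlen : 2 ≤ p.len) {i : ℕ} (hi : 2 ^ (i + 1) < p.len)
    {C : Finset Str} (hC : ∀ s ∈ C, IsBlockString p.bits (2 ^ i) s)
    (hc : (C.card : ℝ) ≤ p.n / Real.logb 2 p.lenBit) :
    ((Nat.log 2 (p.r * 2 ^ i + 1) + 1 : ℕ) : ℝ) * Nat.log 2 (2 * (C.card * 2 ^ i)) ≤
      Real.logb 2 p.lenBit * Real.logb 2 (p.n * p.lenBit) := by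
  have hi' : 2 * 2 ^ i < p.len := by rwa [pow_succ'] at hi
  have hX := p.one_le_logb_lenBit hlen
  have hY := p.natLog_le_logb_mul_lenBit hn hlen (m := 2 ^ i) (by positivity) (by omega) hc
  have hmul : ∀ N : ℕ, N ≠ 0 → N ≤ p.lenBit → (Nat.log 2 N : ℝ) ≤ Real.logb 2 p.lenBit := by
    intro N hN0 hN
    refine (Real.natLog_le_logb _ _).trans (Real.logb_le_logb_of_le (by norm_num)
      (by exact_mod_cast Nat.pos_of_ne_zero hN0) (by exact_mod_cast hN))
  -- A stream has up to k + 1 entries, hence log₂ (2(k + 1)) levels after rounding down. If 2(k + 1)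
  -- ≤ ℓ_bit, the two factors are bounded separately.
  by_cases hbig : (p.r * 2 ^ i + 1) * 2 ≤ p.lenBit
  · rw [← Nat.log_mul_base one_lt_two (Nat.succ_ne_zero _)]
    exact mul_le_mul (hmul _ (by positivity) hbig) hY (Nat.cast_nonneg _) (by linarith)
  -- For r ≥ 2 the inequality ℓ ≥ 2 · 2^i + 1 gives ℓ_bit ≥ 2k + r ≥ 2(k + 1).
  have hr : p.r = 1 := by
    by_contra hr
    have hr2 : 2 ≤ p.r := by
      have : 0 < p.r := Nat.succ_pos _
      omega
    have : p.r * (2 * 2 ^ i + 1) ≤ p.lenBit := by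
      rw [lenBit, mul_comm p.len]
      exact Nat.mul_le_mul_left _ hi'
    apply hbig
    calc _ = p.r * (2 * 2 ^ i) + 2 := by ring
      _ ≤ p.r * (2 * 2 ^ i + 1) := by rw [mul_add, mul_one]; omega
      _ ≤ _ := this
  have hlb : p.lenBit = p.len := by rw [lenBit, hr, mul_one]
  rw [hr, hlb] at hbig
  rw [hr, one_mul]
  rcases i with _ | i
  -- Here 2 levels exceed log₂ 3, so the factors cannot be compared separately. But `$` is the only
  -- block, so |C| ≤ 1, and 2 · 1 ≤ (3/2)² suffices.
  · have h3 : p.len = 3 := by omega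
    have hcard : C.card ≤ 1 := by
      have hb : p.bits = 0 := by rw [r] at hr; omega
      refine Finset.card_le_one.2 fun s hs t ht => ?_
      obtain ⟨x, hx⟩ := (hC s hs).exists_block_prefix (by norm_num)
      obtain ⟨y, hy⟩ := (hC t ht).exists_block_prefix (by norm_num)
      rw [← hx.eq_of_length (by simp [length_block, (hC s hs).length_eq]),
        ← hy.eq_of_length (by simp [length_block, (hC t ht).length_eq])]
      congr 1
      funext j
      exact absurd j.2 (by omega)
    have hK : Nat.log 2 (2 * (C.card * 2 ^ 0)) ≤ 1 :=
      (Nat.log_mono_right (by omega : 2 * (C.card * 2 ^ 0) ≤ 2)).trans (by norm_num)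
    have hX3 : 3 / 2 ≤ Real.logb 2 p.lenBit := by
      rw [hlb, h3]; exact_mod_cast three_halves_le_logb_three
    have hY3 : 3 / 2 ≤ Real.logb 2 (p.n * p.lenBit) :=
      hX3.trans (Real.logb_le_logb_of_le one_lt_two (by rw [hlb, h3]; norm_num)
        (le_mul_of_one_le_left (Nat.cast_nonneg _) (by exact_mod_cast hn)))
    have hM : Nat.log 2 (2 ^ 0 + 1) + 1 = 2 := by
      rw [show 2 ^ 0 + 1 = 2 ^ 1 by norm_num, Nat.log_pow one_lt_two]
    rw [hM]
    calc ((2 : ℕ) : ℝ) * Nat.log 2 (2 * (C.card * 2 ^ 0)) ≤ 2 * 1 := by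
          push_cast; gcongr; exact_mod_cast hK
      _ ≤ 3 / 2 * (3 / 2) := by norm_num
      _ ≤ _ := by gcongr
  -- The extra entry of the stream does not raise the rounded logarithm once k ≥ 2, and 2k < ℓ.
  · have hM : Nat.log 2 (2 ^ (i + 1) + 1) + 1 = Nat.log 2 (2 ^ (i + 1 + 1)) := by
      rw [Nat.log_pow one_lt_two, Nat.log_eq_of_pow_le_of_lt_pow (m := i + 1) (by omega)]
      rw [pow_succ 2 (i + 1)]
      have := Nat.one_lt_two_pow (n := i + 1) (by omega)
      omega
    rw [hM]
    exact mul_le_mul (hmul _ (by positivity) (by rw [hlb]; omega)) hY (Nat.cast_nonneg _)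
      (by linarith)

/-! ### The phases of the main loop -/

/-- The noise variables that are used in the phase with `C_k = C`. -/
def usedNoise (k : ℕ) (C : Finset Str) : Finset (Str × (ℕ × ℕ)) :=
  ((C ×ˢ heads p.hv (sparseSuffixTree p.r C)).image fun i => i.1 ++ i.2) ×ˢ usedNodes (k + 1)

theorem mem_usedNoise {k : ℕ} {C : Finset Str} {s q : Str} (hs : s ∈ C)
    (hq : q ∈ sparseSuffixTree p.r C) (hk : q.length ≤ k) {I : ℕ × ℕ}
    (hI : I ∈ dyadicNodes (q.length - (headOf p.hv (sparseSuffixTree p.r C) q).length + 1)) :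
    (s ++ headOf p.hv (sparseSuffixTree p.r C) q, I) ∈ p.usedNoise k C :=
  Finset.mem_product.2 ⟨Finset.mem_image.2 ⟨(s, _), Finset.mem_product.2
    ⟨hs, headOf_mem_heads mem_sparseSuffixTree_of_prefix hq⟩, rfl⟩,
    dyadicNodes_subset_usedNodes (by omega) hI⟩

theorem extend_congr_noise {k : ℕ} {C : Finset Str} (D : p.Dataset) (z z' : Str × (ℕ × ℕ) → ℝ)
    (h : ∀ i ∈ p.usedNoise k C, z i = z' i) : p.extend k C D z = p.extend k C D z' :=
  p.extend_congr fun _ hs _ hq hk => treeQuery_congr fun _ hI => h _ (p.mem_usedNoise hs hq hk hI)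

/-- The shift of the noise that makes up for the replacement of `D` by `D'`. -/
def noiseShift (k : ℕ) (C : Finset Str) (D D' : p.Dataset) (i : Str × (ℕ × ℕ)) : ℝ :=
  ∑ j ∈ Finset.Ico (i.2.2 * 2 ^ i.2.1) ((i.2.2 + 1) * 2 ^ i.2.1),
    (p.diffVec D (sparseSuffixTree p.r C) (i.1.take k) (i.1.drop k) j -
      p.diffVec D' (sparseSuffixTree p.r C) (i.1.take k) (i.1.drop k) j)

/-- Noise is named by the concatenation of s and the head; since s has length k, cutting at k
recovers both. -/
theorem extend_eq_shift {k : ℕ} {C : Finset Str} (hC : ∀ s ∈ C, s.length = k) (D D' : p.Dataset)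
    (z : Str × (ℕ × ℕ) → ℝ) :
    p.extend k C D z = p.extend k C D' fun i => z i + p.noiseShift k C D D' i := by
  refine p.extend_congr fun s hs q _ _ => ?_
  rw [noisyCount, noisyCount, treeQuery_eq_shift _ (p.diffVec D' (sparseSuffixTree p.r C) s _)]
  refine treeQuery_congr fun I _ => ?_
  simp only [noiseShift]
  rw [← hC s hs, List.take_left, List.drop_left]

theorem sum_usedNoise_abs_noiseShift_le (hhv : IsHeavyChoice p.hv) {m : ℕ} (hm : 0 < m)
    {C : Finset Str} (hC : ∀ s ∈ C, IsBlockString p.bits m s) {D D' : p.Dataset}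
    (h : p.Neighbor D D') :
    ∑ i ∈ p.usedNoise (p.r * m) C, |p.noiseShift (p.r * m) C D D' i| ≤
      (Nat.log 2 (p.r * m + 1) + 1 : ℕ) * (4 * p.len * Nat.log 2 (2 * (C.card * m))) := by
  have hlen : ∀ s ∈ C, s.length = p.r * m := fun s hs => by
    rw [(hC s hs).length_eq, mul_comm]; rfl
  set T := sparseSuffixTree p.r C with hT
  rw [usedNoise, Finset.sum_product, Finset.sum_image, Finset.sum_product]
  -- Every path is given the common stream length k + 1, which covers all queries made up to depth
  -- k.
  · refine le_trans ?_ (mul_le_mul_of_nonneg_left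
      (p.sum_abs_diffVec_sub_le hhv hm hC h fun _ => p.r * m + 1) (Nat.cast_nonneg _))
    rw [Finset.mul_sum]
    refine Finset.sum_le_sum fun s hs => ?_
    rw [Finset.mul_sum]
    refine Finset.sum_le_sum fun u _ => ?_
    refine le_trans (le_of_eq ?_) (sum_usedNodes_abs_le _ _)
    refine Finset.sum_congr rfl fun I _ => ?_
    simp only [noiseShift]
    rw [← hlen s hs, List.take_left, List.drop_left]
  · intro i hi i' hi' heq
    rw [Finset.mem_coe, Finset.mem_product] at hi hi'
    have := List.append_inj heq (by rw [hlen _ hi.1, hlen _ hi'.1])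
    exact Prod.ext this.1 this.2

variable {p}

theorem ε₀_inv_pos (hn : 1 ≤ p.n) (hlen : 2 ≤ p.len) (hε : 0 < p.ε) (hlam : 0 < p.lam) :
    0 < p.ε₀⁻¹ := by
  have h1 := p.one_le_logb_mul_lenBit hn hlen
  have h2 : (0 : ℝ) < p.len := by exact_mod_cast (by omega : 0 < p.len)
  exact inv_pos.2 (div_pos (div_pos hε hlam) (by positivity))

theorem σ_pos (hn : 1 ≤ p.n) (hlen : 2 ≤ p.len) (hε : 0 < p.ε) (hlam : 0 < p.lam) : 0 < p.σ :=
  mul_pos (ε₀_inv_pos hn hlen hε hlam) (by linarith [p.one_le_logb_lenBit hlen])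

theorem isDP_extensionPhase (hn : 1 ≤ p.n) (hlen : 2 ≤ p.len) (hε : 0 < p.ε) (hlam : 0 < p.lam)
    (hhv : IsHeavyChoice p.hv) {i : ℕ} (hi : 2 ^ (i + 1) < p.len) {C : Finset Str}
    (hC : ∀ s ∈ C, IsBlockString p.bits (2 ^ i) s) :
    IsDP p.Neighbor (p.ε / p.lam) (p.extensionPhase (p.r * 2 ^ i) C) := by
  have hdiv : 0 < p.ε / p.lam := div_pos hε hlam
  by_cases hbig : (p.n : ℝ) / Real.logb 2 p.lenBit < C.card
  -- The termination test looks at `C` only, so a terminated phase does not depend on the data.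
  · have : p.extensionPhase (p.r * 2 ^ i) C = fun _ => Measure.dirac ∅ := by
      funext D
      rw [extensionPhase, if_pos hbig]
    rw [this]
    exact isDP_dirac hdiv.le _
  have hform : p.extensionPhase (p.r * 2 ^ i) C = fun D =>
      (Measure.infinitePi fun _ : Str × (ℕ × ℕ) => laplace p.σ).map
        (p.extend (p.r * 2 ^ i) C D) := by
    funext D
    rw [extensionPhase, if_neg hbig]
  have hσ := σ_pos hn hlen hε hlam
  have := isProbabilityMeasure_laplace hσ
  have hCl : ∀ s ∈ C, s.length = p.r * 2 ^ i := fun s hs => by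
    rw [(hC s hs).length_eq, mul_comm]; rfl
  rw [hform]
  refine isDP_of_le (fun _ _ => Neighbor.symm p) (fun D => ?_) fun D D' h => ?_
  · exact Measure.isProbabilityMeasure_map (p.measurable_extend _ _ D).aemeasurable
  · refine map_infinitePi_laplace_le hσ (p.usedNoise (p.r * 2 ^ i) C) (p.measurable_extend _ _ D)
      (p.measurable_extend _ _ D') (p.noiseShift (p.r * 2 ^ i) C D D')
      (p.extend_congr_noise D) (p.extend_congr_noise D') (p.extend_eq_shift hCl D D') ?_
    refine (p.sum_usedNoise_abs_noiseShift_le hhv (by positivity) hC h).trans ?_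
    calc _ = 4 * p.len * (((Nat.log 2 (p.r * 2 ^ i + 1) + 1 : ℕ) : ℝ) *
            Nat.log 2 (2 * (C.card * 2 ^ i))) := by ring
      _ ≤ 4 * p.len * (Real.logb 2 p.lenBit * Real.logb 2 (p.n * p.lenBit)) := by
          exact mul_le_mul_of_nonneg_left
            (p.levels_mul_natLog_le hn hlen hi hC (not_lt.1 hbig)) (by positivity)
      _ = p.ε / p.lam * p.σ := by
          rw [σ, ε₀, inv_div]
          field_simp

/-! ### Composition -/

theorem two_pow_lt_len (hlen : 2 ≤ p.len) {i : ℕ} (hi : i ≤ p.numPhases - 1) :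
    2 ^ i < p.len :=
  (Nat.pow_le_pow_right (by norm_num) hi).trans_lt (Nat.pow_pred_clog_lt_self one_lt_two hlen)

variable (p) in
/-- The property of the candidate sets that is needed for the privacy of the next phase. -/
def IsCandidateSet (m : ℕ) (U : Finset Str) : Prop :=
  ∀ w ∈ U, w.length ≤ p.r * m ∧ (w.length = p.r * m → IsBlockString p.bits m w)

theorem isCandidateSet_block (s : Finset (Fin p.bits → Bool)) :
    p.IsCandidateSet 1 (s.image block) := by
  intro w hw
  obtain ⟨x, -, rfl⟩ := Finset.mem_image.1 hw
  refine ⟨?_, fun _ => isBlockString_block x⟩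
  rw [length_block, mul_one]
  rfl

theorem ae_isCandidateSet_firstPhase (D : p.Dataset) :
    ∀ᵐ U ∂p.firstPhase D, p.IsCandidateSet 1 U := by
  rw [firstPhase, ae_map_iff (p.measurable_firstPhase D).aemeasurable .of_discrete]
  exact ae_of_all _ fun z => isCandidateSet_block _

theorem ae_isCandidateSet_extensionPhase {m : ℕ} (hm : 0 < m) {C : Finset Str}
    (hC : ∀ s ∈ C, IsBlockString p.bits m s) (k : ℕ) (D : p.Dataset) :
    ∀ᵐ N ∂p.extensionPhase k C D, p.IsCandidateSet (m * 2) N := by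
  rw [extensionPhase]
  split_ifs
  · rw [ae_dirac_iff .of_discrete]
    exact fun w hw => absurd hw (Finset.notMem_empty w)
  · rw [ae_map_iff (p.measurable_extend k C D).aemeasurable .of_discrete]
    exact ae_of_all _ fun z w hw => p.isBlockString_of_mem_extend hm hC hw

/-- Strings found earlier are too short to have the new full length. -/
theorem IsCandidateSet.union {m : ℕ} (hm : 0 < m) {U N : Finset Str} (hU : p.IsCandidateSet m U)
    (hN : p.IsCandidateSet (m * 2) N) : p.IsCandidateSet (m * 2) (U ∪ N) := by
  intro w hw
  rcases Finset.mem_union.1 hw with hw | hw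
  · have h1 := (hU w hw).1
    have h2 : 0 < p.r * m := Nat.mul_pos (Nat.succ_pos _) hm
    rw [← mul_assoc]
    omega
  · exact hN w hw

theorem IsCandidateSet.isBlockString {m : ℕ} {U : Finset Str} (hU : p.IsCandidateSet m U) :
    ∀ s ∈ U.filter fun w => w.length = p.r * m, IsBlockString p.bits m s := fun s hs =>
  (hU s (Finset.mem_filter.1 hs).1).2 (Finset.mem_filter.1 hs).2

theorem ae_isCandidateSet_run (D : p.Dataset) :
    ∀ i, ∀ᵐ U ∂p.run D i, p.IsCandidateSet (2 ^ i) U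
  | 0 => ae_isCandidateSet_firstPhase D
  | i + 1 => by
    rw [run, ae_iff, Measure.bind_apply .of_discrete Measurable.of_discrete.aemeasurable]
    refine (lintegral_congr_ae ?_).trans lintegral_zero
    filter_upwards [ae_isCandidateSet_run D i] with U hU
    rw [← ae_iff, ae_map_iff Measurable.of_discrete.aemeasurable .of_discrete]
    filter_upwards [ae_isCandidateSet_extensionPhase (by positivity) hU.isBlockString _ D]
      with N hN
    exact hU.union (by positivity) hN

theorem isDP_run (hn : 1 ≤ p.n) (hlen : 2 ≤ p.len) (hε : 0 < p.ε) (hlam : 0 < p.lam)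
    (hhv : IsHeavyChoice p.hv) :
    ∀ i, i ≤ p.numPhases - 1 → IsDP p.Neighbor ((i + 1 : ℕ) * (p.ε / p.lam)) fun D => p.run D i
  | 0, _ => by
    rw [zero_add, Nat.cast_one, one_mul]
    exact p.isDP_firstPhase hlen hε hlam
  | i + 1, hi => by
    have h := isDP_run hn hlen hε hlam hhv i (by omega)
    rw [Nat.cast_succ (i + 1), add_mul, one_mul]
    exact h.bind (fun _ _ => Neighbor.symm p) (fun D => ae_isCandidateSet_run D i)
      fun U hU => (isDP_extensionPhase hn hlen hε hlam hhv (two_pow_lt_len hlen hi)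
        hU.isBlockString).map .of_discrete

theorem isDP_transcript (hn : 1 ≤ p.n) (hlen : 2 ≤ p.len) (hε : 0 < p.ε) (hlam : 0 < p.lam)
    (hhv : IsHeavyChoice p.hv) :
    IsDP p.Neighbor (p.numPhases * (p.ε / p.lam)) p.transcript := by
  have hpos : 0 < p.numPhases := Nat.clog_pos one_lt_two hlen
  have h := isDP_run hn hlen hε hlam hhv (p.numPhases - 1) le_rfl
  rwa [Nat.sub_add_cancel hpos] at h

theorem isDP_dpFreqSub (hn : 1 ≤ p.n) (hlen : 2 ≤ p.len) (hε : 0 < p.ε) (hlam : 0 < p.lam)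
    (hhv : IsHeavyChoice p.hv) :
    IsDP p.Neighbor (p.numPhases * (p.ε / p.lam)) p.dpFreqSub :=
  (isDP_transcript hn hlen hε hlam hhv).map .of_discrete

end Params
end FreqSub

end

theorem mainTheorem2 {A : Type*} [Fintype A] (p : FreqSub.Params A)
    (hn : 1 ≤ p.n) (hlen : 2 ≤ p.len) (hε : 0 < p.ε) (hlam : 0 < p.lam)
    (hhv : FreqSub.IsHeavyChoice p.hv) :
    -- the first phase is private
    FreqSub.IsDP p.Neighbor (p.ε / p.lam) p.firstPhase ∧
    -- every phase of the main loop is private, for every previous output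
    (∀ i : ℕ, 1 ≤ i → i ≤ p.numPhases - 1 → ∀ C : Finset FreqSub.Str,
      (∀ s ∈ C, FreqSub.IsBlockString p.bits (2 ^ (i - 1)) s) →
      FreqSub.IsDP p.Neighbor (p.ε / p.lam) (p.extensionPhase (p.r * 2 ^ (i - 1)) C)) ∧
    -- sensitivity of the difference vectors, unless the algorithm terminates
    (∀ i : ℕ, 1 ≤ i → i ≤ p.numPhases → ∀ C : Finset FreqSub.Str,
      (∀ s ∈ C, FreqSub.IsBlockString p.bits (2 ^ (i - 1)) s) →
      (C.card : ℝ) ≤ p.n / Real.logb 2 p.lenBit →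
      ∀ D D' : p.Dataset, p.Neighbor D D' →
        p.heavyPathDistance C D D' ≤ 4 * p.len * Real.logb 2 (p.n * p.lenBit)) ∧
    -- composition of the phases
    FreqSub.IsDP p.Neighbor (p.numPhases * (p.ε / p.lam)) p.transcript ∧
    FreqSub.IsDP p.Neighbor (p.numPhases * (p.ε / p.lam)) p.dpFreqSub ∧
    -- privacy of the algorithm
    ((p.numPhases : ℝ) ≤ p.lam → FreqSub.IsDP p.Neighbor p.ε p.dpFreqSub) := by
  have hpow : ∀ i, 1 ≤ i → i ≤ p.numPhases - 1 → 2 ^ (i - 1 + 1) < p.len := fun i h1 hi => by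
    rw [Nat.sub_add_cancel h1]
    exact FreqSub.Params.two_pow_lt_len hlen hi
  have hdp := FreqSub.Params.isDP_dpFreqSub hn hlen hε hlam hhv
  refine ⟨p.isDP_firstPhase hlen hε hlam, fun i h1 hi C hC =>
    FreqSub.Params.isDP_extensionPhase hn hlen hε hlam hhv (hpow i h1 hi) hC,
    fun i h1 hi C hC hcard D D' h => ?_,
    FreqSub.Params.isDP_transcript hn hlen hε hlam hhv, hdp, fun hL => hdp.mono ?_⟩
  -- The sensitivity bound needs only 2^(i-1) < ℓ, so it also holds for i = L.
  · refine (p.sum_abs_diffVec_sub_le hhv (by positivity) hC h _).trans ?_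
    gcongr
    exact p.natLog_le_logb_mul_lenBit hn hlen (by positivity)
      (FreqSub.Params.two_pow_lt_len hlen (by omega)) hcard
  · rw [mul_div_assoc', div_le_iff₀ hlam, mul_comm]
    gcongr
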